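/- Let $q:\mathbb R\to\mathbb C$ be a measurable function with $\int_{\mathbb R}(1+|x|)\,|q(x)|\,dx<\infty$. Let $H=-\frac{d^2}{dx^2}+q$ be the Schrödinger operator in $L^2(\mathbb R)$ with its maximal domain: all $y\in L^2(\mathbb R)$ such that $y$ and $y'$ are locally absolutely continuous and $-y''+qy\in L^2(\mathbb R)$. The algebraic multiplicity of an eigenvalue $E$ of $H$ is $\dim\bigcup_{n\ge1}\ker(H-E)^n$. Let $k_1,k_2,\dots$ ($N\le\infty$ of them) be the points $k$ of $\mathbb C_+=\{k\in\mathbb C:\operatorname{Im}k>0\}$ for which $k^2$ is an eigenvalue of $H$, each repeated according to the algebraic multiplicity of $k^2$, and let $$B(k)=\prod_{j=1}^{N}\frac{k-k_j}{k-\overline{k_j}},\qquad k\in\mathbb C_+ .$$ Put $q_0=\int_{\mathbb R}q(x)\,dx$, $\|q\|=\int_{\mathbb R}|q(x)|\,dx$, $\|q\|_1=\int_{\mathbb R}|x\,q(x)|\,dx$ and $A=\|q\|\,\|q\|_1\,e^{\|q\|_1}$. Then: (i) These eigenvalues have finite algebraic multiplicity, the product $B(k)$ converges absolutely for every $k\in\mathbb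 C_+$, and $B$ belongs to the Hardy space $H^\infty(\mathbb C_+)$ of bounded holomorphic functions on $\mathbb C_+$, with $\|B\|_{H^\infty}=\sup_{k\in\mathbb C_+}|B(k)|\le1$. (ii) If $A<\operatorname{Re}q_0$, then $H$ has no eigenvalues. If $A<-\operatorname{Re}q_0$, then $H$ has exactly one eigenvalue; it has algebraic multiplicity one and lies in $\mathbb C\setminus[0,\infty)$. -/

import Mathlib

open MeasureTheory
open scoped ENNReal ComplexConjugate

/-! ### Eigenvalues and root spaces of unbounded operators -/

namespace LinearPMap

variable {X : Type*} [AddCommGroup X] [Module ℂ X]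

/-- `E` is an eigenvalue of the unbounded operator `T`: there is a nonzero vector `y` in the
domain of `T` such that `T y = E y`. -/
def IsEigenvalue (T : X →ₗ.[ℂ] X) (E : ℂ) : Prop :=
  ∃ y : T.domain, (y : X) ≠ 0 ∧ T y = E • (y : X)

/-- The kernel of `(T - E)ⁿ` for an unbounded operator `T`, with its natural domain:
`y` belongs to the kernel of `(T - E)ⁿ⁺¹` if and only if `y` belongs to the domain of `T`
and `T y - E y` belongs to the kernel of `(T - E)ⁿ`. -/
def kerPow (T : X →ₗ.[ℂ] X) (E : ℂ) : ℕ → Submodule ℂ X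
  | 0 => ⊥
  | n + 1 => ((kerPow T E n).comap (T.toFun - E • T.domain.subtype)).map T.domain.subtype

/-- The root space (generalized eigenspace) of `T` at `E`: the union of the increasing sequence
of the kernels of `(T - E)ⁿ`. -/
def rootSpace (T : X →ₗ.[ℂ] X) (E : ℂ) : Submodule ℂ X := ⨆ n : ℕ, kerPow T E n

/-- The algebraic multiplicity of `E`: the dimension of the root space
(by convention `0` if that dimension is infinite). -/
noncomputable def algMult (T : X →ₗ.[ℂ] X) (E : ℂ) : ℕ := Module.finrank ℂ (rootSpace T E)

theorem mem_kerPow_succ (T : X →ₗ.[ℂ] X) (E : ℂ) (n : ℕ) (y : X) :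
    y ∈ kerPow T E (n + 1) ↔ ∃ z : T.domain, (z : X) = y ∧ T z - E • (z : X) ∈ kerPow T E n := by
  simp only [kerPow, Submodule.mem_map, Submodule.mem_comap]
  constructor
  · rintro ⟨z, hz, rfl⟩
    exact ⟨z, rfl, hz⟩
  · rintro ⟨z, rfl, hz⟩
    exact ⟨z, hz, rfl⟩

end LinearPMap

/-! ### The Schrödinger operator on the line -/

namespace Schrodinger

/-- The Hilbert space `L²(ℝ)` of complex-valued functions. -/
abbrev L2 : Type := Lp ℂ 2 (volume : Measure ℝ)

/-- `-y'' + q y = g` for `y, g ∈ L²(ℝ)`: the class `y` has a differentiable representative `u`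
whose derivative `v` is locally absolutely continuous with `v' = q u - g` almost everywhere.
(Local absolute continuity of `v` together with `v' = q u - g` a.e. is written as: `q u - g` is
integrable on bounded intervals and `v` is a primitive of it.) -/
def IsPair (q : ℝ → ℂ) (y g : L2) : Prop :=
  ∃ u v : ℝ → ℂ, (y : ℝ → ℂ) =ᵐ[volume] u ∧
    (∀ x, HasDerivAt u (v x) x) ∧
    (∀ a b : ℝ, IntervalIntegrable (fun t => q t * u t - g t) volume a b) ∧
    ∀ a b : ℝ, v b - v a = ∫ t in a..b, (q t * u t - g t)

/-- The graph of the Schrödinger operator `-d²/dx² + q` on its maximal domain. -/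
def graph (q : ℝ → ℂ) : Submodule ℂ (L2 × L2) where
  carrier := {p | IsPair q p.1 p.2}
  zero_mem' := by
    have h0 : ((0 : L2) : ℝ → ℂ) =ᵐ[volume] 0 := Lp.coeFn_zero ℂ 2 volume
    have h1 : (fun t => q t * (0 : ℂ) - ((0 : L2) : ℝ → ℂ) t) =ᵐ[volume] fun _ => (0 : ℂ) := by
      filter_upwards with t
      simp
    refine ⟨fun _ => 0, fun _ => 0, h0, fun x => hasDerivAt_const x 0, fun a b => ?_,
      fun a b => ?_⟩
    · exact (intervalIntegrable_const (c := (0 : ℂ))).congr_ae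
        (ae_restrict_of_ae h1.symm)
    · have := intervalIntegral.integral_congr_ae (a := a) (b := b) (h1.mono fun t ht _ => ht)
      simp only [Prod.snd_zero]
      rw [this]
      simp
  add_mem' := by
    rintro ⟨y₁, g₁⟩ ⟨y₂, g₂⟩ ⟨u₁, v₁, hy₁, hu₁, hi₁, hv₁⟩ ⟨u₂, v₂, hy₂, hu₂, hi₂, hv₂⟩
    have h1 : (fun t => (q t * u₁ t - g₁ t) + (q t * u₂ t - g₂ t)) =ᵐ[volume]
        fun t => q t * (u₁ t + u₂ t) - ((g₁ + g₂ : L2) : ℝ → ℂ) t := by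
      filter_upwards [Lp.coeFn_add g₁ g₂] with t ht
      rw [ht, Pi.add_apply]
      ring
    refine ⟨fun t => u₁ t + u₂ t, fun t => v₁ t + v₂ t, ?_, fun x => (hu₁ x).add (hu₂ x),
      fun a b => ?_, fun a b => ?_⟩
    · filter_upwards [Lp.coeFn_add y₁ y₂, hy₁, hy₂] with t ht ht₁ ht₂
      change ((y₁ + y₂ : L2) : ℝ → ℂ) t = _
      rw [ht, Pi.add_apply, ht₁, ht₂]
    · exact ((hi₁ a b).add (hi₂ a b)).congr_ae (ae_restrict_of_ae h1)
    · have := intervalIntegral.integral_congr_ae (a := a) (b := b) (h1.mono fun t ht _ => ht)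
      change _ = ∫ t in a..b, (q t * (u₁ t + u₂ t) - ((g₁ + g₂ : L2) : ℝ → ℂ) t)
      rw [← this, intervalIntegral.integral_add (hi₁ a b) (hi₂ a b)]
      have e₁ := hv₁ a b
      have e₂ := hv₂ a b
      simp only at e₁ e₂
      rw [← e₁, ← e₂]
      ring
  smul_mem' := by
    rintro c ⟨y, g⟩ ⟨u, v, hy, hu, hi, hv⟩
    have h1 : (fun t => c * (q t * u t - g t)) =ᵐ[volume]
        fun t => q t * (c * u t) - ((c • g : L2) : ℝ → ℂ) t := by
      filter_upwards [Lp.coeFn_smul c g] with t ht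
      rw [ht, Pi.smul_apply, smul_eq_mul]
      ring
    refine ⟨fun t => c * u t, fun t => c * v t, ?_, fun x => (hu x).const_mul c,
      fun a b => ?_, fun a b => ?_⟩
    · filter_upwards [Lp.coeFn_smul c y, hy] with t ht ht₁
      change ((c • y : L2) : ℝ → ℂ) t = _
      rw [ht, Pi.smul_apply, ht₁, smul_eq_mul]
    · exact ((hi a b).const_mul c).congr_ae (ae_restrict_of_ae h1)
    · have := intervalIntegral.integral_congr_ae (a := a) (b := b) (h1.mono fun t ht _ => ht)
      change _ = ∫ t in a..b, (q t * (c * u t) - ((c • g : L2) : ℝ → ℂ) t)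
      rw [← this, intervalIntegral.integral_const_mul]
      have e := hv a b
      simp only at e
      rw [← e]
      ring

/-- The Schrödinger operator `H = -d²/dx² + q` in `L²(ℝ)`, on its maximal domain: the functions
`y ∈ L²(ℝ)` such that `y` and `y'` are locally absolutely continuous and `-y'' + q y ∈ L²(ℝ)`. -/
noncomputable def H (q : ℝ → ℂ) : L2 →ₗ.[ℂ] L2 := (graph q).toLinearPMap

theorem graph_functional (q : ℝ → ℂ) (p : L2 × L2) (hp : p ∈ graph q) (h0 : p.1 = 0) :
    p.2 = 0 := by
  obtain ⟨y, g⟩ := p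
  obtain ⟨u, v, hy, hu, hi, hv⟩ := hp
  simp only at h0 hy hi hv ⊢
  subst h0
  have hu0 : u = fun _ => 0 := by
    have hc : Continuous u := continuous_iff_continuousAt.2 fun x => (hu x).continuousAt
    have h1 : u =ᵐ[volume] fun _ => (0 : ℂ) := hy.symm.trans (Lp.coeFn_zero ℂ 2 volume)
    exact (hc.ae_eq_iff_eq volume continuous_const).1 h1
  have hv0 : ∀ x, v x = 0 := fun x => by
    have := hu x
    rw [hu0] at this
    exact this.unique (hasDerivAt_const x 0)
  have hloc : LocallyIntegrable (fun t => g t) volume :=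
    (Lp.memLp g).locallyIntegrable (by norm_num)
  have hint : ∀ b : ℝ, ∫ t in (0 : ℝ)..b, g t = 0 := fun b => by
    have := hv 0 b
    simp only [hu0, hv0, mul_zero, zero_sub, sub_zero, intervalIntegral.integral_neg] at this
    simpa using this.symm
  rw [Lp.eq_zero_iff_ae_eq_zero]
  filter_upwards [_root_.LocallyIntegrable.ae_hasDerivAt_integral hloc] with x hx
  have h2 := hx 0
  have h3 : (fun b => ∫ t in (0 : ℝ)..b, g t) = fun _ => (0 : ℂ) := funext hint
  rw [h3] at h2
  exact h2.unique (hasDerivAt_const x 0)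

/-- The graph of the operator `H` is the one it was built from. -/
theorem H_graph (q : ℝ → ℂ) : (H q).graph = graph q :=
  Submodule.toLinearPMap_graph_eq _ fun p hp h0 => graph_functional q p hp h0

/-- `k` in the open upper half-plane is an eigenvalue of `H` in the momentum variable if `k ^ 2`
is an eigenvalue of `H`. (The map `k ↦ k ^ 2` is a bijection of the open upper half-plane onto
`ℂ ∖ [0, ∞)`.) -/
def momenta (q : ℝ → ℂ) : Set ℂ := {k | 0 < k.im ∧ (H q).IsEigenvalue (k ^ 2)}

/-- Index set of the eigenvalues `k_j`, each repeated according to its algebraic multiplicity. -/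
abbrev Index (q : ℝ → ℂ) : Type := Σ κ : momenta q, Fin ((H q).algMult ((κ : ℂ) ^ 2))

/-- The factor `(k - k_j) / (k - conj k_j)` of the Blaschke product. -/
noncomputable def factor (q : ℝ → ℂ) (k : ℂ) (j : Index q) : ℂ :=
  (k - (j.1 : ℂ)) / (k - conj (j.1 : ℂ))

/-- The Blaschke product over the eigenvalues, counted with algebraic multiplicity. -/
noncomputable def blaschke (q : ℝ → ℂ) (k : ℂ) : ℂ := ∏' j : Index q, factor q k j

/-- The norm of the Hardy space `H^∞` of the upper half-plane. -/
noncomputable def hardyNorm (F : ℂ → ℂ) : ℝ≥0∞ := ⨆ k ∈ {z : ℂ | 0 < z.im}, ‖F k‖ₑ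

/-- Membership in the Hardy space `H^∞` of the upper half-plane: holomorphic and bounded. -/
def MemHardy (F : ℂ → ℂ) : Prop :=
  DifferentiableOn ℂ F {z : ℂ | 0 < z.im} ∧ hardyNorm F < ∞

/-- `‖q‖ = ∫ |q(x)| dx`. -/
noncomputable def norm0 (q : ℝ → ℂ) : ℝ := ∫ x, ‖q x‖

/-- `‖q‖₁ = ∫ |x q(x)| dx`. -/
noncomputable def norm1 (q : ℝ → ℂ) : ℝ := ∫ x, |x| * ‖q x‖

/-- `A = ‖q‖ ‖q‖₁ exp ‖q‖₁`. -/
noncomputable def constA (q : ℝ → ℂ) : ℝ := norm0 q * norm1 q * Real.exp (norm1 q)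

end Schrodinger

/-
Neumann series for the Volterra equations on the two half-lines, whose kernel is bounded by `t` for
`Im k ≥ 0`, give the Jost solutions and their Wronskian `W(k)`. It is holomorphic in the upper
half-plane, and `|W(k) - 2ik + q₀| ≤ A` there. The eigenvalues of `H` are the `k²` with `W(k) = 0`;
eigenvalues in `[0, ∞)` do not occur, because for real `k` the solutions behave like `exp (±ikx)`
at infinity.

A Jordan chain `u₀, …, u_{m-1}` at `k²` gives `u_ε = ∑ εʲ uⱼ` with `(H - k² - ε) u_ε = O(εᵐ)`.
Comparing `u_ε` with the two Jost solutions shows that `W` vanishes at `k` to order at least `m`,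
so the algebraic multiplicity of `k²` is at most the order of this zero. As `W(k) / (k + i)` is
bounded in the upper half-plane, dividing out Blaschke factors gives `∑ Im kⱼ < ∞`, whence the
convergence of the Blaschke product.

If `A < Re q₀`, then `W` has no zeros. The zeros of `W` are the fixed points of
`k ↦ k - W(k) / (2i)`, which maps the upper half-plane into the closed disc of radius `A / 2` about
`q₀ / (2i)`. If `A < -Re q₀`, this disc is a compact subset of the upper half-plane, and strict
contraction of the pseudo-hyperbolic distance yields exactly one fixed point, with derivative of
modulus less than one; hence exactly one zero of `W`, and it is simple.
-/

open Set Filter Topology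
open Complex (I exp)
open UpperHalfPlane (upperHalfPlaneSet isOpen_upperHalfPlaneSet)

/-! ### Primitives on the half-line -/

/-- `F` is on `[0, ∞)` a primitive of the locally integrable function `f`, that is, `F` is locally
absolutely continuous there with `F' = f` almost everywhere. Values on `(-∞, 0)` are irrelevant. -/
def IsHalfLinePrimitive {E : Type*} [NormedAddCommGroup E] [NormedSpace ℝ E] (F f : ℝ → E) : Prop :=
  ∀ x, 0 ≤ x → IntervalIntegrable f volume 0 x ∧ F x = F 0 + ∫ t in (0 : ℝ)..x, f t

section Primitive

variable {E : Type*} [NormedAddCommGroup E] [NormedSpace ℝ E] {F G f g : ℝ → E}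

theorem continuous_of_sub_eq_integral (hi : ∀ a b, IntervalIntegrable f volume a b)
    (h : ∀ a b, F b - F a = ∫ t in a..b, f t) : Continuous F :=
  ((intervalIntegral.continuous_primitive hi 0).add_const (F 0)).congr fun x => by
    rw [← h, sub_add_cancel]

theorem absolutelyContinuousOnInterval_primitive {a b : ℝ}
    (hf : IntervalIntegrable f volume a b) :
    AbsolutelyContinuousOnInterval (fun x => ∫ t in a..x, f t) a b := by
  have real_case := hf.norm.absolutelyContinuousOnInterval_intervalIntegral (c := a) (by simp)
  rw [absolutelyContinuousOnInterval_iff] at real_case ⊢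
  intro ε hε
  obtain ⟨δ, hδ, h⟩ := real_case ε hε
  refine ⟨δ, hδ, fun J hJ hlt => (Finset.sum_le_sum fun i hi => ?_).trans_lt (h J hJ hlt)⟩
  obtain ⟨hc, hd⟩ := hJ.1 i (by simpa using hi)
  have integrable_to {y} (hy : y ∈ uIcc a b) : IntervalIntegrable f volume a y :=
    hf.mono_set (uIcc_subset_uIcc (by simp) hy)
  rw [dist_eq_norm, dist_eq_norm,
    intervalIntegral.integral_interval_sub_left (integrable_to hc) (integrable_to hd),
    intervalIntegral.integral_interval_sub_left (integrable_to hc).norm (integrable_to hd).norm]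
  exact intervalIntegral.norm_integral_le_abs_integral_norm

namespace IsHalfLinePrimitive

theorem congr_ae (h : IsHalfLinePrimitive F f) (hfg : ∀ᵐ t, 0 < t → f t = g t) :
    IsHalfLinePrimitive F g := by
  intro x hx
  have hfg' : ∀ᵐ t, t ∈ uIoc 0 x → f t = g t := by
    filter_upwards [hfg] with t ht ht0
    rw [uIoc_of_le hx] at ht0
    exact ht ht0.1
  refine ⟨(h x hx).1.congr_ae ((ae_restrict_iff' measurableSet_uIoc).2 hfg'), ?_⟩
  rw [(h x hx).2, intervalIntegral.integral_congr_ae hfg']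

theorem congr (h : IsHalfLinePrimitive F f) (hfg : ∀ t, 0 < t → f t = g t) :
    IsHalfLinePrimitive F g :=
  h.congr_ae (Eventually.of_forall hfg)

theorem congr_left (h : IsHalfLinePrimitive F f) (hFG : ∀ t, 0 ≤ t → F t = G t) :
    IsHalfLinePrimitive G f := by
  intro x hx
  rw [← hFG x hx, ← hFG 0 le_rfl]
  exact h x hx

theorem sub_eq_integral (h : IsHalfLinePrimitive F f) {a b : ℝ} (ha : 0 ≤ a) (hb : 0 ≤ b) :
    F b - F a = ∫ t in a..b, f t := by
  rw [(h a ha).2, (h b hb).2,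
    ← intervalIntegral.integral_interval_sub_left (h b hb).1 (h a ha).1, add_sub_add_left_eq_sub]

theorem sub_eq_integral_of_reflect (hr : IsHalfLinePrimitive F f)
    (hl : IsHalfLinePrimitive (fun t => F (-t)) fun t => -f (-t)) (a b : ℝ) :
    IntervalIntegrable f volume a b ∧ F b - F a = ∫ t in a..b, f t := by
  have from_zero (x : ℝ) :
      IntervalIntegrable f volume 0 x ∧ F x = F 0 + ∫ t in (0 : ℝ)..x, f t := by
    rcases le_total 0 x with hx | hx
    · exact hr x hx
    · obtain ⟨hint, heq⟩ := hl (-x) (neg_nonneg.2 hx)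
      refine ⟨by simpa [Pi.neg_def] using (hint.comp_sub_left (c := 0)).neg, ?_⟩
      beta_reduce at heq
      rw [neg_neg, neg_zero, intervalIntegral.integral_neg, intervalIntegral.integral_comp_neg,
        neg_neg, neg_zero] at heq
      rw [heq, intervalIntegral.integral_symm, neg_neg]
  refine ⟨(from_zero a).1.symm.trans (from_zero b).1, ?_⟩
  rw [(from_zero a).2, (from_zero b).2, add_sub_add_left_eq_sub,
    intervalIntegral.integral_interval_sub_left (from_zero b).1 (from_zero a).1]

theorem add (hF : IsHalfLinePrimitive F f) (hG : IsHalfLinePrimitive G g) :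
    IsHalfLinePrimitive (fun x => F x + G x) (fun x => f x + g x) := by
  intro x hx
  refine ⟨(hF x hx).1.add (hG x hx).1, ?_⟩
  beta_reduce
  rw [intervalIntegral.integral_add (hF x hx).1 (hG x hx).1, (hF x hx).2, (hG x hx).2,
    add_add_add_comm]

theorem sub (hF : IsHalfLinePrimitive F f) (hG : IsHalfLinePrimitive G g) :
    IsHalfLinePrimitive (fun x => F x - G x) (fun x => f x - g x) := by
  intro x hx
  refine ⟨(hF x hx).1.sub (hG x hx).1, ?_⟩
  beta_reduce
  rw [intervalIntegral.integral_sub (hF x hx).1 (hG x hx).1, (hF x hx).2, (hG x hx).2,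
    add_sub_add_comm]

theorem absolutelyContinuousOnInterval (h : IsHalfLinePrimitive F f) {x : ℝ} (hx : 0 ≤ x) :
    AbsolutelyContinuousOnInterval F 0 x := by
  have const_ac : AbsolutelyContinuousOnInterval (fun _ : ℝ => F 0) 0 x :=
    (LipschitzWith.const (F 0)).lipschitzOnWith.absolutelyContinuousOnInterval
  have ac := const_ac.add (absolutelyContinuousOnInterval_primitive (h x hx).1)
  have eqOn : EqOn F ((fun _ => F 0) + fun y => ∫ t in (0 : ℝ)..y, f t) (uIcc 0 x) := by
    intro y hy
    rw [uIcc_of_le hx] at hy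
    exact (h y hy.1).2
  rw [absolutelyContinuousOnInterval_iff] at ac ⊢
  intro ε hε
  obtain ⟨δ, hδ, hac⟩ := ac ε hε
  refine ⟨δ, hδ, fun J hJ hlt => (Finset.sum_congr rfl fun i hi => ?_).trans_lt (hac J hJ hlt)⟩
  obtain ⟨hc, hd⟩ := hJ.1 i (by simpa using hi)
  rw [eqOn hc, eqOn hd]

theorem continuousOn (h : IsHalfLinePrimitive F f) : ContinuousOn F (Ici 0) := by
  intro x (hx : 0 ≤ x)
  have hx1 : 0 ≤ x + 1 := by linarith
  have hF := (h.absolutelyContinuousOnInterval hx1).continuousOn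
  rw [uIcc_of_le hx1] at hF
  refine (hF x ⟨hx, by linarith⟩).mono_of_mem_nhdsWithin ?_
  filter_upwards [mem_nhdsWithin_of_mem_nhds (Iio_mem_nhds (lt_add_one x)), self_mem_nhdsWithin]
    with t ht ht0 using ⟨ht0, ht.le⟩

theorem continuousOn_uIcc (h : IsHalfLinePrimitive F f) {a b : ℝ} (ha : 0 ≤ a) (hb : 0 ≤ b) :
    ContinuousOn F (uIcc a b) :=
  h.continuousOn.mono fun _ ht => (le_min ha hb).trans ht.1

variable [CompleteSpace E]

theorem of_hasDerivAt (h : ∀ x, HasDerivAt F (f x) x) (hf : Continuous f) :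
    IsHalfLinePrimitive F f := fun x _ =>
  ⟨hf.intervalIntegrable _ _, by
    rw [intervalIntegral.integral_eq_sub_of_hasDerivAt (fun t _ => h t)
      (hf.intervalIntegrable _ _), add_sub_cancel]⟩

theorem ae_hasDerivAt (h : IsHalfLinePrimitive F f) : ∀ᵐ t, 0 < t → HasDerivAt F (f t) t := by
  have on_intervals : ∀ᵐ t, ∀ n : ℕ, t ∈ uIcc 0 (n : ℝ) → ∀ c ∈ uIcc 0 (n : ℝ),
      HasDerivAt (fun x => ∫ s in c..x, f s) (f t) t :=
    ae_all_iff.2 fun n => (h n n.cast_nonneg).1.ae_hasDerivAt_integral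
  filter_upwards [on_intervals] with t ht ht0
  obtain ⟨n, hn⟩ := exists_nat_ge t
  have deriv_integral := ht n (by rw [uIcc_of_le (by positivity)]; exact ⟨ht0.le, hn⟩) 0 (by simp)
  refine (deriv_integral.const_add (F 0)).congr_of_eventuallyEq ?_
  filter_upwards [Ioi_mem_nhds ht0] with y hy using (h y (le_of_lt hy)).2

theorem of_ae_hasDerivAt (hF : ∀ x, 0 ≤ x → AbsolutelyContinuousOnInterval F 0 x)
    (hf : ∀ x, 0 ≤ x → IntervalIntegrable f volume 0 x)
    (hFf : ∀ᵐ t, 0 < t → HasDerivAt F (f t) t) : IsHalfLinePrimitive F f := by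
  intro x hx
  refine ⟨hf x hx, ?_⟩
  have ac := (hF x hx).sub (absolutelyContinuousOnInterval_primitive (hf x hx))
  obtain ⟨C, hC⟩ := ac.const_of_ae_hasDerivAt_zero (by
    filter_upwards [hFf, (hf x hx).ae_hasDerivAt_integral, Measure.ae_ne volume 0]
      with t hFt hft ht0 ht
    have t_pos : 0 < t := lt_of_le_of_ne (by rw [uIcc_of_le hx] at ht; exact ht.1) ht0.symm
    simpa using (hFt t_pos).sub (hft ht 0 (by simp)))
  have at_zero := hC 0 (by simp)
  have at_x := hC x (by simp)
  simp only [Pi.sub_apply, intervalIntegral.integral_same, sub_zero] at at_zero at_x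
  rw [at_zero, ← at_x, sub_add_cancel]

end IsHalfLinePrimitive

theorem setIntegral_Ioi_eq_sub (hf : IntegrableOn f (Ioi 0)) {x : ℝ} (hx : 0 ≤ x) :
    ∫ t in Ioi x, f t = (∫ t in Ioi 0, f t) - ∫ t in (0 : ℝ)..x, f t := by
  rw [← intervalIntegral.integral_Ioi_sub_Ioi hf hx, sub_sub_cancel]

theorem isHalfLinePrimitive_integral_Ioi (hf : IntegrableOn f (Ioi 0)) :
    IsHalfLinePrimitive (fun x => ∫ t in Ioi x, f t) (fun x => -f x) := by
  intro x hx
  refine ⟨((intervalIntegrable_iff_integrableOn_Ioc_of_le hx).2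
    (hf.mono_set Ioc_subset_Ioi_self)).neg, ?_⟩
  beta_reduce
  rw [intervalIntegral.integral_neg, setIntegral_Ioi_eq_sub hf hx, sub_eq_add_neg]

theorem tendsto_integral_Ioi_zero (hf : IntegrableOn f (Ioi 0)) :
    Tendsto (fun x => ∫ t in Ioi x, f t) atTop (𝓝 0) := by
  have hlim := (intervalIntegral_tendsto_integral_Ioi 0 hf tendsto_id).const_sub
    (∫ t in Ioi 0, f t)
  rw [sub_self] at hlim
  refine hlim.congr' ?_
  filter_upwards [eventually_ge_atTop 0] with x hx using (setIntegral_Ioi_eq_sub hf hx).symm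

end Primitive

namespace IsHalfLinePrimitive

variable {𝕜 : Type*} [RCLike 𝕜] {F G f g : ℝ → 𝕜}

theorem const_mul (c : 𝕜) (hF : IsHalfLinePrimitive F f) :
    IsHalfLinePrimitive (fun x => c * F x) (fun x => c * f x) := by
  intro x hx
  refine ⟨(hF x hx).1.const_mul c, ?_⟩
  beta_reduce
  rw [intervalIntegral.integral_const_mul, (hF x hx).2, mul_add]

theorem mul (hF : IsHalfLinePrimitive F f) (hG : IsHalfLinePrimitive G g) :
    IsHalfLinePrimitive (fun x => F x * G x) (fun x => f x * G x + F x * g x) := by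
  refine of_ae_hasDerivAt (fun x hx => ?_) (fun x hx => ?_) ?_
  · exact (hF.absolutelyContinuousOnInterval hx).smul (hG.absolutelyContinuousOnInterval hx)
  · exact ((hF x hx).1.mul_continuousOn (hG.continuousOn_uIcc le_rfl hx)).add
      ((hG x hx).1.continuousOn_mul (hF.continuousOn_uIcc le_rfl hx))
  · filter_upwards [hF.ae_hasDerivAt, hG.ae_hasDerivAt] with t hFt hGt ht
    exact (hFt ht).mul (hGt ht)

theorem pow_succ (hF : IsHalfLinePrimitive F f) (n : ℕ) :
    IsHalfLinePrimitive (fun x => F x ^ (n + 1)) (fun x => ((n : 𝕜) + 1) * (f x * F x ^ n)) := by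
  induction n with
  | zero => simpa using hF
  | succ n ih =>
    have h := ih.mul hF
    simp only [← _root_.pow_succ] at h
    refine h.congr fun t _ => ?_
    push_cast
    ring

end IsHalfLinePrimitive

section TailPowers

variable {p : ℝ → ℝ}

theorem setIntegral_Ioi_anti (hp : IntegrableOn p (Ioi 0)) (hp0 : ∀ t, 0 ≤ p t) {x y : ℝ}
    (hx : 0 ≤ x) (hxy : x ≤ y) : ∫ t in Ioi y, p t ≤ ∫ t in Ioi x, p t :=
  setIntegral_mono_set (hp.mono_set (Ioi_subset_Ioi hx)) (Eventually.of_forall hp0)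
    (Ioi_subset_Ioi hxy).eventuallyLE

theorem integrableOn_mul_tail_pow (hp : IntegrableOn p (Ioi 0)) (hp0 : ∀ t, 0 ≤ p t) (n : ℕ) :
    IntegrableOn (fun t => p t * (∫ s in Ioi t, p s) ^ n) (Ioi 0) := by
  have tail_continuous :=
    (isHalfLinePrimitive_integral_Ioi hp).continuousOn.mono Ioi_subset_Ici_self
  refine hp.mul_bdd (c := (∫ s in Ioi 0, p s) ^ n)
    ((tail_continuous.pow n).aestronglyMeasurable measurableSet_Ioi)
    (ae_restrict_of_forall_mem measurableSet_Ioi fun t ht => ?_)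
  have tail_nonneg : 0 ≤ ∫ s in Ioi t, p s := integral_nonneg hp0
  rw [norm_pow, Real.norm_of_nonneg tail_nonneg]
  exact pow_le_pow_left₀ tail_nonneg (setIntegral_Ioi_anti hp hp0 le_rfl (le_of_lt ht)) n

theorem integral_mul_tail_pow (hp : IntegrableOn p (Ioi 0)) (hp0 : ∀ t, 0 ≤ p t) (n : ℕ)
    {x : ℝ} (hx : 0 ≤ x) :
    ∫ t in Ioi x, p t * (∫ s in Ioi t, p s) ^ n = (∫ s in Ioi x, p s) ^ (n + 1) / (n + 1) := by
  have integral_to (y : ℝ) (hy : x ≤ y) : ∫ t in x..y, p t * (∫ s in Ioi t, p s) ^ n =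
      ((∫ s in Ioi x, p s) ^ (n + 1) - (∫ s in Ioi y, p s) ^ (n + 1)) / (n + 1) := by
    have h := ((isHalfLinePrimitive_integral_Ioi hp).pow_succ n).sub_eq_integral hx (hx.trans hy)
    simp only [neg_mul, intervalIntegral.integral_const_mul, intervalIntegral.integral_neg] at h
    rw [eq_div_iff (by positivity)]
    linarith
  have hlim : Tendsto
      (fun y => ((∫ s in Ioi x, p s) ^ (n + 1) - (∫ s in Ioi y, p s) ^ (n + 1)) / ((n : ℝ) + 1))
      atTop (𝓝 ((∫ s in Ioi x, p s) ^ (n + 1) / (n + 1))) := by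
    simpa using (((tendsto_integral_Ioi_zero hp).pow (n + 1)).const_sub
      ((∫ s in Ioi x, p s) ^ (n + 1))).div_const ((n : ℝ) + 1)
  refine tendsto_nhds_unique (intervalIntegral_tendsto_integral_Ioi x
    ((integrableOn_mul_tail_pow hp hp0 n).mono_set (Ioi_subset_Ioi hx)) tendsto_id) (hlim.congr' ?_)
  filter_upwards [eventually_ge_atTop x] with y hy using (integral_to y hy).symm

end TailPowers

section Gronwall

variable {s p : ℝ → ℝ}

theorem le_mul_pow_div_factorial_of_le_integral (hs : ContinuousOn s (Ici 0))
    (hp : ∀ x, 0 ≤ x → IntervalIntegrable p volume 0 x) (hp0 : ∀ t, 0 ≤ p t)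
    (hle : ∀ x, 0 ≤ x → s x ≤ ∫ t in (0 : ℝ)..x, p t * s t) {x M : ℝ}
    (hM : ∀ y ∈ Icc 0 x, s y ≤ M) (n : ℕ) {y : ℝ} (hy : y ∈ Icc 0 x) :
    s y ≤ M * ((∫ t in (0 : ℝ)..y, p t) ^ n / n.factorial) := by
  have primitive_p : IsHalfLinePrimitive (fun x => ∫ t in (0 : ℝ)..x, p t) p :=
    fun y hy => ⟨hp y hy, by simp⟩
  induction n generalizing y with
  | zero => simpa using hM y hy
  | succ n ih =>
    have integral_pow := (primitive_p.pow_succ n y hy.1).2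
    simp only [intervalIntegral.integral_same, ne_eq, Nat.add_eq_zero_iff, one_ne_zero, and_false,
      not_false_eq_true, zero_pow, zero_add, intervalIntegral.integral_const_mul] at integral_pow
    have integrable_pow : IntervalIntegrable
        (fun t => p t * (∫ r in (0 : ℝ)..t, p r) ^ n) volume 0 y :=
      (hp y hy.1).mul_continuousOn ((primitive_p.continuousOn_uIcc le_rfl hy.1).pow n)
    have integrable_mul : IntervalIntegrable (fun t => p t * s t) volume 0 y :=
      (hp y hy.1).mul_continuousOn (hs.mono fun t ht => (le_min le_rfl hy.1).trans ht.1)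
    calc s y ≤ ∫ t in (0 : ℝ)..y, p t * s t := hle y hy.1
      _ ≤ ∫ t in (0 : ℝ)..y, M / n.factorial * (p t * (∫ r in (0 : ℝ)..t, p r) ^ n) := by
        refine intervalIntegral.integral_mono_on hy.1 integrable_mul (integrable_pow.const_mul _)
          fun t ht => (mul_le_mul_of_nonneg_left (ih ⟨ht.1, ht.2.trans hy.2⟩) (hp0 t)).trans_eq ?_
        ring
      _ = M * ((∫ t in (0 : ℝ)..y, p t) ^ (n + 1) / (n + 1).factorial) := by
        rw [intervalIntegral.integral_const_mul, integral_pow, Nat.factorial_succ]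
        push_cast
        field_simp

theorem nonpos_of_le_integral (hs : ContinuousOn s (Ici 0))
    (hp : ∀ x, 0 ≤ x → IntervalIntegrable p volume 0 x) (hp0 : ∀ t, 0 ≤ p t)
    (hle : ∀ x, 0 ≤ x → s x ≤ ∫ t in (0 : ℝ)..x, p t * s t) {x : ℝ} (hx : 0 ≤ x) : s x ≤ 0 := by
  obtain ⟨M, hM⟩ := (isCompact_Icc (a := (0 : ℝ)) (b := x)).exists_bound_of_continuousOn
    (hs.mono Icc_subset_Ici_self)
  have hlim : Tendsto (fun n : ℕ => M * ((∫ t in (0 : ℝ)..x, p t) ^ n / n.factorial)) atTop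
      (𝓝 0) := by
    simpa using (FloorSemiring.tendsto_pow_div_factorial_atTop _).const_mul M
  exact ge_of_tendsto' hlim fun n => le_mul_pow_div_factorial_of_le_integral hs hp hp0 hle
    (fun y hy => (le_abs_self _).trans (hM y hy)) n ⟨hx, le_rfl⟩

theorem cauchyData_eq_zero_unique {u v r : ℝ → ℂ} (hu : IsHalfLinePrimitive u v)
    (hv : IsHalfLinePrimitive v fun t => r t * u t)
    (hr : ∀ x, 0 ≤ x → IntervalIntegrable r volume 0 x)
    (hu0 : u 0 = 0) (hv0 : v 0 = 0) {x : ℝ} (hx : 0 ≤ x) : u x = 0 ∧ v x = 0 := by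
  have weight_integrable (x : ℝ) (hx : 0 ≤ x) :
      IntervalIntegrable (fun t => 1 + ‖r t‖) volume 0 x :=
    intervalIntegrable_const.add (hr x hx).norm
  have sum_continuous : ContinuousOn (fun t => ‖u t‖ + ‖v t‖) (Ici 0) :=
    hu.continuousOn.norm.add hv.continuousOn.norm
  have sum_le_integral (x : ℝ) (hx : 0 ≤ x) :
      ‖u x‖ + ‖v x‖ ≤ ∫ t in (0 : ℝ)..x, (1 + ‖r t‖) * (‖u t‖ + ‖v t‖) := by
    have u_le : ‖u x‖ ≤ ∫ t in (0 : ℝ)..x, ‖v t‖ := by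
      rw [(hu x hx).2, hu0, zero_add]
      exact intervalIntegral.norm_integral_le_integral_norm hx
    have v_le : ‖v x‖ ≤ ∫ t in (0 : ℝ)..x, ‖r t * u t‖ := by
      rw [(hv x hx).2, hv0, zero_add]
      exact intervalIntegral.norm_integral_le_integral_norm hx
    calc ‖u x‖ + ‖v x‖ ≤ ∫ t in (0 : ℝ)..x, (‖v t‖ + ‖r t * u t‖) := by
          rw [intervalIntegral.integral_add (hu x hx).1.norm (hv x hx).1.norm]
          exact add_le_add u_le v_le
      _ ≤ ∫ t in (0 : ℝ)..x, (1 + ‖r t‖) * (‖u t‖ + ‖v t‖) := by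
          refine intervalIntegral.integral_mono_on hx ((hu x hx).1.norm.add (hv x hx).1.norm)
            ((weight_integrable x hx).mul_continuousOn (sum_continuous.mono fun t ht =>
              (le_min le_rfl hx).trans ht.1)) fun t _ => ?_
          rw [norm_mul]
          linarith [norm_nonneg (u t), mul_nonneg (norm_nonneg (r t)) (norm_nonneg (v t))]
  have sum_nonpos := nonpos_of_le_integral sum_continuous weight_integrable
    (fun t => by positivity) sum_le_integral hx
  exact ⟨norm_le_zero_iff.1 (by linarith [norm_nonneg (v x)]),
    norm_le_zero_iff.1 (by linarith [norm_nonneg (u x)])⟩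

end Gronwall

/-! ### Holomorphic dependence of integrals on a parameter -/

section Holomorphic

variable {α : Type*} [MeasurableSpace α] {μ : Measure α}

theorem aestronglyMeasurable_of_ae_hasDerivAt {𝕜 E : Type*} [NontriviallyNormedField 𝕜]
    [NormedAddCommGroup E] [NormedSpace 𝕜 E] {F : 𝕜 → α → E} {F' : α → E} {k : 𝕜}
    (hF : ∀ᶠ z in 𝓝 k, AEStronglyMeasurable (F z) μ)
    (hF' : ∀ᵐ t ∂μ, HasDerivAt (fun z => F z t) (F' t) k) : AEStronglyMeasurable F' μ := by
  obtain ⟨z, hz, hFz⟩ := exists_seq_forall_of_frequently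
    (eventually_nhdsWithin_of_eventually_nhds hF : ∀ᶠ z in 𝓝[≠] k, _).frequently
  refine aestronglyMeasurable_of_tendsto_ae atTop (f := fun n t => slope (fun z => F z t) k (z n))
    (fun n => ((hFz n).sub hF.self_of_nhds).const_smul _) ?_
  filter_upwards [hF'] with t ht using (hasDerivAt_iff_tendsto_slope.1 ht).comp hz

theorem differentiableOn_integral_of_norm_le {E : Type*} [NormedAddCommGroup E] [NormedSpace ℂ E]
    {U : Set ℂ} (hU : IsOpen U) {F : ℂ → α → E} {b : α → ℝ}
    (hb : Integrable b μ) (hm : ∀ k ∈ U, AEStronglyMeasurable (F k) μ)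
    (hd : ∀ᵐ t ∂μ, DifferentiableOn ℂ (fun k => F k t) U)
    (hF : ∀ᵐ t ∂μ, ∀ k ∈ U, ‖F k t‖ ≤ b t) :
    DifferentiableOn ℂ (fun k => ∫ t, F k t ∂μ) U := by
  intro k hk
  obtain ⟨ε, hε, hball⟩ := Metric.isOpen_iff.1 hU k hk
  have half_pos : 0 < ε / 2 := half_pos hε
  have closedBall_subset (z : ℂ) (hz : z ∈ Metric.ball k (ε / 2)) :
      Metric.closedBall z (ε / 2) ⊆ U := fun w hw => hball <| by
    rw [Metric.mem_ball] at hz ⊢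
    linarith [dist_triangle w z k, Metric.mem_closedBall.1 hw]
  have hderiv : ∀ᵐ t ∂μ, ∀ z ∈ Metric.ball k (ε / 2),
      HasDerivAt (fun w => F w t) (deriv (fun w => F w t) z) z := by
    filter_upwards [hd] with t ht z hz
    exact (ht.differentiableAt (hU.mem_nhds
      (closedBall_subset z hz (Metric.mem_closedBall_self half_pos.le)))).hasDerivAt
  -- Cauchy's estimate turns the bound for `F` into a bound for its derivative.
  have deriv_bound : ∀ᵐ t ∂μ, ∀ z ∈ Metric.ball k (ε / 2),
      ‖deriv (fun w => F w t) z‖ ≤ b t / (ε / 2) := by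
    filter_upwards [hd, hF] with t ht hFt z hz
    refine Complex.norm_deriv_le_of_forall_mem_sphere_norm_le half_pos
      (ht.mono ?_).diffContOnCl fun w hw =>
        hFt w (closedBall_subset z hz (Metric.sphere_subset_closedBall hw))
    exact Metric.closure_ball_subset_closedBall.trans (closedBall_subset z hz)
  have measurable_near : ∀ᶠ z in 𝓝 k, AEStronglyMeasurable (F z) μ :=
    (hU.eventually_mem hk).mono hm
  have deriv_measurable : AEStronglyMeasurable (fun t => deriv (fun w => F w t) k) μ :=
    aestronglyMeasurable_of_ae_hasDerivAt measurable_near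
      (hderiv.mono fun t ht => ht k (Metric.mem_ball_self half_pos))
  have hint : Integrable (F k) μ := hb.mono' (hm k hk) (hF.mono fun t ht => ht k hk)
  exact (hasDerivAt_integral_of_dominated_loc_of_deriv_le (Metric.ball_mem_nhds k half_pos)
    measurable_near hint deriv_measurable deriv_bound (hb.div_const _)
    hderiv).2.differentiableAt.differentiableWithinAt

end Holomorphic

/-! ### Jost solutions on the half-line -/

namespace Schrodinger

/-- The kernel `s ↦ ∫₀ˢ exp (2 i k r) dr` of the Volterra equation for the Jost solution. For
`k ≠ 0` it is `(exp (2 i k s) - 1) / (2 i k)`. -/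
noncomputable def jostKernel (k : ℂ) (s : ℝ) : ℂ :=
  ∫ r in (0 : ℝ)..s, exp (2 * I * k * r)

/-- Integrability of `q` on the half-line `(0, ∞)`, also with the weight `|x|`. -/
structure HalfLineIntegrable (q : ℝ → ℂ) : Prop where
  integrableOn : IntegrableOn q (Ioi 0)
  integrableOn_moment : IntegrableOn (fun t => |t| * ‖q t‖) (Ioi 0)

/-- The tail `∫ₓ^∞ |t q(t)| dt` of the first moment of `q`. -/
noncomputable def momentTail (q : ℝ → ℂ) (x : ℝ) : ℝ := ∫ t in Ioi x, |t| * ‖q t‖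

/-- The terms of the Neumann series of the Volterra equation for the Jost solution. The integrals
are extended from `(x, ∞)` to `(0, ∞)`, on which the truncated kernel vanishes for `t ≤ x`. -/
noncomputable def jostIter (q : ℝ → ℂ) (k : ℂ) : ℕ → ℝ → ℂ
  | 0 => fun _ => 1
  | n + 1 => fun x => ∫ t in Ioi 0, jostKernel k (max (t - x) 0) * (q t * jostIter q k n t)

/-- The Jost solution divided by `exp (i k x)`. -/
noncomputable def jostReduced (q : ℝ → ℂ) (k : ℂ) (x : ℝ) : ℂ := ∑' n, jostIter q k n x

section Kernel

variable {k : ℂ}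

theorem norm_exp_I_mul (k : ℂ) (r : ℝ) : ‖exp (I * k * r)‖ = Real.exp (-k.im * r) := by
  simp [Complex.norm_exp]

theorem norm_exp_two_I_mul (k : ℂ) (r : ℝ) :
    ‖exp (2 * I * k * r)‖ = Real.exp (-2 * k.im * r) := by
  simp [Complex.norm_exp]

theorem norm_exp_two_I_mul_le_one (hk : 0 ≤ k.im) {r : ℝ} (hr : 0 ≤ r) :
    ‖exp (2 * I * k * r)‖ ≤ 1 := by
  rw [norm_exp_two_I_mul, Real.exp_le_one_iff]
  linarith [mul_nonneg hk hr]

theorem norm_jostKernel_le (hk : 0 ≤ k.im) {s : ℝ} (hs : 0 ≤ s) : ‖jostKernel k s‖ ≤ s := by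
  have h := intervalIntegral.norm_integral_le_of_norm_le_const (a := 0) (b := s) (C := 1)
    (f := fun r : ℝ => exp (2 * I * k * r)) fun r hr => by
      rw [uIoc_of_le hs] at hr
      exact norm_exp_two_I_mul_le_one hk hr.1.le
  simpa [jostKernel, abs_of_nonneg hs] using h

theorem hasDerivAt_jostKernel (k : ℂ) (s : ℝ) :
    HasDerivAt (jostKernel k) (exp (2 * I * k * s)) s :=
  (Continuous.integral_hasStrictDerivAt (by fun_prop) 0 s).hasDerivAt

theorem continuous_jostKernel (k : ℂ) : Continuous (jostKernel k) :=
  continuous_iff_continuousAt.2 fun s => (hasDerivAt_jostKernel k s).continuousAt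

theorem jostKernel_eq_div (hk : k ≠ 0) (s : ℝ) :
    jostKernel k s = (exp (2 * I * k * s) - 1) / (2 * I * k) := by
  rw [jostKernel, integral_exp_mul_complex (by simp [hk])]
  simp

theorem two_I_mul_jostKernel (k : ℂ) (s : ℝ) :
    2 * I * k * jostKernel k s = exp (2 * I * k * s) - 1 := by
  rcases eq_or_ne k 0 with rfl | hk
  · simp
  · rw [jostKernel_eq_div hk, mul_div_cancel₀ _ (by simp [hk])]

theorem jostKernel_sub (k : ℂ) (t x : ℝ) :
    jostKernel k (t - x) = exp (-(2 * I * k * x)) * jostKernel k t + jostKernel k (-x) := by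
  rcases eq_or_ne k 0 with rfl | hk
  · simp [jostKernel, sub_eq_add_neg]
  · apply mul_left_cancel₀ (show 2 * I * k ≠ 0 by simp [hk])
    rw [mul_add, mul_left_comm, two_I_mul_jostKernel, two_I_mul_jostKernel, two_I_mul_jostKernel,
      mul_sub, ← Complex.exp_add]
    push_cast
    ring_nf

theorem differentiableOn_jostKernel (s : ℝ) :
    DifferentiableOn ℂ (fun k => jostKernel k s) upperHalfPlaneSet := by
  have ne_zero (k : ℂ) (hk : k ∈ upperHalfPlaneSet) : k ≠ 0 := by
    rintro rfl
    exact lt_irrefl (0 : ℝ) hk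
  refine DifferentiableOn.congr (f := fun k : ℂ => (exp (2 * I * k * s) - 1) / (2 * I * k))
    (DifferentiableOn.div (by fun_prop) (by fun_prop) fun k hk => ?_) fun k hk =>
      jostKernel_eq_div (ne_zero k hk) s
  simp [ne_zero k hk]

theorem setIntegral_jostKernel_max (k : ℂ) (f : ℝ → ℂ) {x : ℝ} (hx : 0 ≤ x) :
    ∫ t in Ioi 0, jostKernel k (max (t - x) 0) * f t =
      ∫ t in Ioi x, jostKernel k (t - x) * f t := by
  have eqOn_indicator : EqOn (fun t => jostKernel k (max (t - x) 0) * f t)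
      ((Ioi x).indicator fun t => jostKernel k (t - x) * f t) (Ioi 0) := by
    intro t _
    beta_reduce
    rcases lt_or_ge x t with hxt | htx
    · rw [indicator_of_mem (mem_Ioi.2 hxt), max_eq_left (sub_nonneg.2 hxt.le)]
    · rw [indicator_of_notMem (notMem_Ioi.2 htx)]
      simp [max_eq_right (sub_nonpos.2 htx), jostKernel]
  rw [setIntegral_congr_fun measurableSet_Ioi eqOn_indicator,
    setIntegral_indicator measurableSet_Ioi, Ioi_inter_Ioi, max_eq_right hx]

end Kernel

section NeumannSeries

variable {q : ℝ → ℂ} {k : ℂ}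

theorem moment_nonneg (t : ℝ) : 0 ≤ |t| * ‖q t‖ := by positivity

theorem momentTail_nonneg (x : ℝ) : 0 ≤ momentTail q x := integral_nonneg moment_nonneg

theorem HalfLineIntegrable.momentTail_anti (hq : HalfLineIntegrable q) {x y : ℝ} (hx : 0 ≤ x)
    (hxy : x ≤ y) : momentTail q y ≤ momentTail q x :=
  setIntegral_Ioi_anti hq.integrableOn_moment moment_nonneg hx hxy

theorem norm_jostKernel_mul_le (hk : 0 ≤ k.im) {s t : ℝ} (hs : 0 ≤ s) (hst : s ≤ t) {z : ℂ} {c : ℝ}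
    (hz : ‖z‖ ≤ c) : ‖jostKernel k s * (q t * z)‖ ≤ |t| * ‖q t‖ * c := by
  rw [norm_mul, norm_mul, ← mul_assoc]
  have kernel_le : ‖jostKernel k s‖ ≤ |t| :=
    (norm_jostKernel_le hk hs).trans (hst.trans (le_abs_self t))
  gcongr

theorem norm_jostKernel_max_mul_le (hk : 0 ≤ k.im) {x t : ℝ} (hx : 0 ≤ x) (ht : 0 ≤ t) {z : ℂ}
    {c : ℝ} (hz : ‖z‖ ≤ c) :
    ‖jostKernel k (max (t - x) 0) * (q t * z)‖ ≤ |t| * ‖q t‖ * c :=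
  norm_jostKernel_mul_le hk (le_max_right _ _) (max_le (by linarith) ht) hz

theorem aestronglyMeasurable_jostKernel_mul (hq : HalfLineIntegrable q) {m : ℝ → ℂ}
    (hm : ContinuousOn m (Ici 0)) (x : ℝ) :
    AEStronglyMeasurable (fun t => jostKernel k (max (t - x) 0) * (q t * m t))
      (volume.restrict (Ioi 0)) :=
  ((continuous_jostKernel k).comp (by fun_prop)).aestronglyMeasurable.mul
    (hq.integrableOn.aestronglyMeasurable.mul
      ((hm.mono Ioi_subset_Ici_self).aestronglyMeasurable measurableSet_Ioi))

theorem continuousOn_jostIter_succ (hq : HalfLineIntegrable q) (hk : 0 ≤ k.im) {n : ℕ} {c : ℝ}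
    (hcont : ContinuousOn (jostIter q k n) (Ici 0)) (hc : ∀ t, 0 ≤ t → ‖jostIter q k n t‖ ≤ c) :
    ContinuousOn (jostIter q k (n + 1)) (Ici 0) :=
  continuousOn_of_dominated (bound := fun t => |t| * ‖q t‖ * c)
    (fun x _ => aestronglyMeasurable_jostKernel_mul hq hcont x)
    (fun x hx => ae_restrict_of_forall_mem measurableSet_Ioi fun t ht =>
      norm_jostKernel_max_mul_le hk hx (le_of_lt ht) (hc t (le_of_lt ht)))
    (hq.integrableOn_moment.mul_const c)
    (Eventually.of_forall fun _ =>
      (((continuous_jostKernel k).comp (by fun_prop)).mul continuous_const).continuousOn)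

theorem norm_jostIter_le (hq : HalfLineIntegrable q) (hk : 0 ≤ k.im) (n : ℕ) {x : ℝ}
    (hx : 0 ≤ x) : ‖jostIter q k n x‖ ≤ momentTail q x ^ n / n.factorial := by
  induction n generalizing x with
  | zero => simp [jostIter]
  | succ n ih =>
    have integrable_bound :
        IntegrableOn (fun t => |t| * ‖q t‖ * (momentTail q t ^ n / n.factorial)) (Ioi x) := by
      simp only [← mul_div_assoc]
      exact ((integrableOn_mul_tail_pow hq.integrableOn_moment moment_nonneg n).mono_set
        (Ioi_subset_Ioi hx)).div_const _
    calc ‖jostIter q k (n + 1) x‖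
        = ‖∫ t in Ioi x, jostKernel k (t - x) * (q t * jostIter q k n t)‖ := by
          rw [← setIntegral_jostKernel_max k _ hx, jostIter]
      _ ≤ ∫ t in Ioi x, |t| * ‖q t‖ * (momentTail q t ^ n / n.factorial) :=
          norm_integral_le_of_norm_le integrable_bound <|
            ae_restrict_of_forall_mem measurableSet_Ioi fun t (ht : x < t) =>
              norm_jostKernel_mul_le hk (by linarith) (by linarith) (ih (hx.trans ht.le))
      _ = momentTail q x ^ (n + 1) / (n + 1).factorial := by
          simp only [← mul_div_assoc, integral_div]
          rw [show ∫ t in Ioi x, |t| * ‖q t‖ * momentTail q t ^ n = _ from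
            integral_mul_tail_pow hq.integrableOn_moment moment_nonneg n hx, Nat.factorial_succ,
            div_div]
          push_cast
          rfl

theorem norm_jostIter_le_const (hq : HalfLineIntegrable q) (hk : 0 ≤ k.im) (n : ℕ) {x : ℝ}
    (hx : 0 ≤ x) : ‖jostIter q k n x‖ ≤ momentTail q 0 ^ n / n.factorial := by
  refine (norm_jostIter_le hq hk n hx).trans ?_
  have tail_le := hq.momentTail_anti le_rfl hx
  have tail_nonneg := momentTail_nonneg (q := q) x
  gcongr

theorem continuousOn_jostIter (hq : HalfLineIntegrable q) (hk : 0 ≤ k.im) (n : ℕ) :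
    ContinuousOn (jostIter q k n) (Ici 0) := by
  induction n with
  | zero => exact continuousOn_const
  | succ n ih => exact continuousOn_jostIter_succ hq hk ih fun _ => norm_jostIter_le_const hq hk n

theorem differentiableOn_jostIter (hq : HalfLineIntegrable q) (n : ℕ) {x : ℝ} (hx : 0 ≤ x) :
    DifferentiableOn ℂ (fun k => jostIter q k n x) upperHalfPlaneSet := by
  induction n generalizing x with
  | zero => exact differentiableOn_const _
  | succ n ih =>
    refine differentiableOn_integral_of_norm_le isOpen_upperHalfPlaneSet
      (hq.integrableOn_moment.mul_const (momentTail q 0 ^ n / n.factorial))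
      (fun k hk => aestronglyMeasurable_jostKernel_mul hq (continuousOn_jostIter hq (le_of_lt hk) n)
        x)
      (ae_restrict_of_forall_mem measurableSet_Ioi fun t ht => ?_)
      (ae_restrict_of_forall_mem measurableSet_Ioi fun t ht k hk => ?_)
    · exact (differentiableOn_jostKernel _).mul ((ih (le_of_lt ht)).const_mul _)
    · exact norm_jostKernel_max_mul_le (le_of_lt hk) hx (le_of_lt ht)
        (norm_jostIter_le_const hq (le_of_lt hk) n (le_of_lt ht))

theorem hasSum_pow_div_factorial (y : ℝ) :
    HasSum (fun n : ℕ => y ^ n / n.factorial) (Real.exp y) := by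
  rw [Real.exp_eq_exp_ℝ]
  exact NormedSpace.expSeries_div_hasSum_exp y

theorem summable_jostIter (hq : HalfLineIntegrable q) (hk : 0 ≤ k.im) {x : ℝ} (hx : 0 ≤ x) :
    Summable fun n => jostIter q k n x :=
  (hasSum_pow_div_factorial (momentTail q x)).summable.of_norm_bounded
    fun n => norm_jostIter_le hq hk n hx

theorem norm_jostReduced_le (hq : HalfLineIntegrable q) (hk : 0 ≤ k.im) {x : ℝ} (hx : 0 ≤ x) :
    ‖jostReduced q k x‖ ≤ Real.exp (momentTail q x) :=
  tsum_of_norm_bounded (hasSum_pow_div_factorial _) fun n => norm_jostIter_le hq hk n hx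

theorem jostReduced_eq_one_add_tsum (hq : HalfLineIntegrable q) (hk : 0 ≤ k.im) {x : ℝ}
    (hx : 0 ≤ x) : jostReduced q k x = 1 + ∑' n, jostIter q k (n + 1) x := by
  rw [jostReduced, (summable_jostIter hq hk hx).tsum_eq_zero_add]
  rfl

theorem norm_jostReduced_sub_one_le (hq : HalfLineIntegrable q) (hk : 0 ≤ k.im) {x : ℝ}
    (hx : 0 ≤ x) : ‖jostReduced q k x - 1‖ ≤ Real.exp (momentTail q x) - 1 := by
  have hasSum_succ := (hasSum_nat_add_iff' 1).2 (hasSum_pow_div_factorial (momentTail q x))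
  simp only [Finset.range_one, Finset.sum_singleton, pow_zero, Nat.factorial_zero, Nat.cast_one,
    div_one] at hasSum_succ
  rw [jostReduced_eq_one_add_tsum hq hk hx, add_sub_cancel_left]
  exact tsum_of_norm_bounded hasSum_succ fun n => norm_jostIter_le hq hk (n + 1) hx

theorem continuousOn_jostReduced (hq : HalfLineIntegrable q) (hk : 0 ≤ k.im) :
    ContinuousOn (jostReduced q k) (Ici 0) :=
  continuousOn_tsum (continuousOn_jostIter hq hk)
    (hasSum_pow_div_factorial (momentTail q 0)).summable fun n _ => norm_jostIter_le_const hq hk n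

theorem differentiableOn_jostReduced (hq : HalfLineIntegrable q) {x : ℝ} (hx : 0 ≤ x) :
    DifferentiableOn ℂ (fun k => jostReduced q k x) upperHalfPlaneSet :=
  Complex.differentiableOn_tsum_of_summable_norm
    (hasSum_pow_div_factorial (momentTail q x)).summable
    (fun n => differentiableOn_jostIter hq n hx) isOpen_upperHalfPlaneSet
    fun n _ hk => norm_jostIter_le hq (le_of_lt hk) n hx

theorem jostReduced_eq_one_add_integral (hq : HalfLineIntegrable q) (hk : 0 ≤ k.im) {x : ℝ}
    (hx : 0 ≤ x) :
    jostReduced q k x = 1 + ∫ t in Ioi x, jostKernel k (t - x) * (q t * jostReduced q k t) := by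
  have hasSum_iter : HasSum (fun n => jostIter q k (n + 1) x)
      (∫ t in Ioi 0, jostKernel k (max (t - x) 0) * (q t * jostReduced q k t)) := by
    have summable_exp := (hasSum_pow_div_factorial (momentTail q 0)).summable
    refine hasSum_integral_of_dominated_convergence
      (fun n t => |t| * ‖q t‖ * (momentTail q 0 ^ n / n.factorial))
      (fun n => aestronglyMeasurable_jostKernel_mul hq (continuousOn_jostIter hq hk n) x)
      (fun n => ae_restrict_of_forall_mem measurableSet_Ioi fun t ht =>
        norm_jostKernel_max_mul_le hk hx (le_of_lt ht)
          (norm_jostIter_le_const hq hk n (le_of_lt ht)))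
      (Eventually.of_forall fun t => summable_exp.mul_left _) ?_
      (ae_restrict_of_forall_mem measurableSet_Ioi fun t ht =>
        ((summable_jostIter hq hk (le_of_lt ht)).hasSum.mul_left _).mul_left _)
    simp only [tsum_mul_left]
    exact hq.integrableOn_moment.mul_const _
  rw [jostReduced_eq_one_add_tsum hq hk hx, hasSum_iter.tsum_eq,
    setIntegral_jostKernel_max k _ hx]

end NeumannSeries

/-- The product of the potential with the reduced Jost solution, that is, the source term in the
Volterra equation. -/
noncomputable def jostSource (q : ℝ → ℂ) (k : ℂ) (t : ℝ) : ℂ := q t * jostReduced q k t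

/-- The tail `∫ₓ^∞ exp (2 i k t) q(t) m(t) dt`, where `m` is the reduced Jost solution. The
derivative of `m` is `-exp (-2 i k x)` times this tail. -/
noncomputable def jostTail (q : ℝ → ℂ) (k : ℂ) (x : ℝ) : ℂ :=
  ∫ t in Ioi x, exp (2 * I * k * t) * jostSource q k t

/-- The Jost solution of `-f'' + q f = k² f` on the half-line `[0, ∞)`, asymptotic to
`exp (i k x)`. -/
noncomputable def jost (q : ℝ → ℂ) (k : ℂ) (x : ℝ) : ℂ := exp (I * k * x) * jostReduced q k x

/-- The derivative of the Jost solution. -/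
noncomputable def jostDeriv (q : ℝ → ℂ) (k : ℂ) (x : ℝ) : ℂ :=
  I * k * jost q k x - exp (-(I * k) * x) * jostTail q k x

variable {q : ℝ → ℂ} {k : ℂ}

theorem HalfLineIntegrable.intervalIntegrable (hq : HalfLineIntegrable q) {x : ℝ} (hx : 0 ≤ x) :
    IntervalIntegrable q volume 0 x :=
  (intervalIntegrable_iff_integrableOn_Ioc_of_le hx).2
    (hq.integrableOn.mono_set Ioc_subset_Ioi_self)

section Source

theorem norm_jostReduced_le_const (hq : HalfLineIntegrable q) (hk : 0 ≤ k.im) {x : ℝ}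
    (hx : 0 ≤ x) : ‖jostReduced q k x‖ ≤ Real.exp (momentTail q 0) :=
  (norm_jostReduced_le hq hk hx).trans (Real.exp_le_exp.2 (hq.momentTail_anti le_rfl hx))

theorem norm_jostSource_le (hq : HalfLineIntegrable q) (hk : 0 ≤ k.im) {t : ℝ} (ht : 0 ≤ t) :
    ‖jostSource q k t‖ ≤ ‖q t‖ * Real.exp (momentTail q 0) := by
  rw [jostSource, norm_mul]
  exact mul_le_mul_of_nonneg_left (norm_jostReduced_le_const hq hk ht) (norm_nonneg _)

theorem integrableOn_jostSource (hq : HalfLineIntegrable q) (hk : 0 ≤ k.im) :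
    IntegrableOn (jostSource q k) (Ioi 0) :=
  hq.integrableOn.mul_bdd
    (((continuousOn_jostReduced hq hk).mono Ioi_subset_Ici_self).aestronglyMeasurable
      measurableSet_Ioi)
    (ae_restrict_of_forall_mem measurableSet_Ioi fun _ ht =>
      norm_jostReduced_le_const hq hk (le_of_lt ht))

theorem integrableOn_exp_mul_jostSource (hq : HalfLineIntegrable q) (hk : 0 ≤ k.im) :
    IntegrableOn (fun t : ℝ => exp (2 * I * k * t) * jostSource q k t) (Ioi 0) :=
  (integrableOn_jostSource hq hk).bdd_mul (c := 1)
    (Continuous.aestronglyMeasurable (by fun_prop))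
    (ae_restrict_of_forall_mem measurableSet_Ioi fun _ ht =>
      norm_exp_two_I_mul_le_one hk (le_of_lt ht))

theorem integrableOn_jostKernel_mul_jostSource (hq : HalfLineIntegrable q) (hk : 0 ≤ k.im) :
    IntegrableOn (fun t : ℝ => jostKernel k t * jostSource q k t) (Ioi 0) :=
  (hq.integrableOn_moment.mul_const _).mono'
    ((continuous_jostKernel k).aestronglyMeasurable.mul
      (integrableOn_jostSource hq hk).aestronglyMeasurable)
    (ae_restrict_of_forall_mem measurableSet_Ioi fun _ ht =>
      norm_jostKernel_mul_le hk (le_of_lt ht) le_rfl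
        (norm_jostReduced_le_const hq hk (le_of_lt ht)))

theorem integral_norm_jostSource_le (hq : HalfLineIntegrable q) (hk : 0 ≤ k.im) :
    ∫ t in Ioi 0, ‖jostSource q k t‖ ≤ (∫ t in Ioi 0, ‖q t‖) * Real.exp (momentTail q 0) := by
  rw [← integral_mul_const]
  exact setIntegral_mono_on (integrableOn_jostSource hq hk).norm
    (hq.integrableOn.norm.mul_const _) measurableSet_Ioi
    fun t ht => norm_jostSource_le hq hk (le_of_lt ht)

theorem norm_integral_jostSource_sub_le (hq : HalfLineIntegrable q) (hk : 0 ≤ k.im) :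
    ‖(∫ t in Ioi 0, jostSource q k t) - ∫ t in Ioi 0, q t‖ ≤
      (∫ t in Ioi 0, ‖q t‖) * (Real.exp (momentTail q 0) - 1) := by
  rw [← integral_sub (integrableOn_jostSource hq hk) hq.integrableOn, ← integral_mul_const]
  refine norm_integral_le_of_norm_le (hq.integrableOn.norm.mul_const _)
    (ae_restrict_of_forall_mem measurableSet_Ioi fun t ht => ?_)
  rw [jostSource, ← mul_sub_one, norm_mul]
  refine mul_le_mul_of_nonneg_left ?_ (norm_nonneg _)
  refine (norm_jostReduced_sub_one_le hq hk (le_of_lt ht)).trans ?_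
  have tail_le := hq.momentTail_anti le_rfl (le_of_lt ht)
  gcongr

end Source

section Tails

theorem jostReduced_eq_tails (hq : HalfLineIntegrable q) (hk : 0 ≤ k.im) {x : ℝ} (hx : 0 ≤ x) :
    jostReduced q k x = 1 +
      (exp (-(2 * I * k) * x) * (∫ t in Ioi x, jostKernel k t * jostSource q k t) +
        jostKernel k (-x) * ∫ t in Ioi x, jostSource q k t) := by
  rw [jostReduced_eq_one_add_integral hq hk hx, ← integral_const_mul, ← integral_const_mul,
    ← integral_add]
  · congr 2
    ext t
    rw [jostKernel_sub, jostSource]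
    ring_nf
  · exact ((integrableOn_jostKernel_mul_jostSource hq hk).mono_set (Ioi_subset_Ioi hx)).const_mul _
  · exact ((integrableOn_jostSource hq hk).mono_set (Ioi_subset_Ioi hx)).const_mul _

theorem jostTail_eq (hq : HalfLineIntegrable q) (hk : 0 ≤ k.im) {x : ℝ} (hx : 0 ≤ x) :
    jostTail q k x = (∫ t in Ioi x, jostSource q k t) +
      2 * I * k * ∫ t in Ioi x, jostKernel k t * jostSource q k t := by
  rw [jostTail, ← integral_const_mul, ← integral_add]
  · congr 1
    ext t
    rw [← mul_assoc, two_I_mul_jostKernel]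
    ring
  · exact (integrableOn_jostSource hq hk).mono_set (Ioi_subset_Ioi hx)
  · exact ((integrableOn_jostKernel_mul_jostSource hq hk).mono_set (Ioi_subset_Ioi hx)).const_mul _

theorem two_I_mul_jostReduced_zero_sub_one (hq : HalfLineIntegrable q) (hk : 0 ≤ k.im) :
    2 * I * k * (jostReduced q k 0 - 1) = jostTail q k 0 - ∫ t in Ioi 0, jostSource q k t := by
  rw [jostTail_eq hq hk le_rfl, jostReduced_eq_tails hq hk le_rfl]
  simp [jostKernel]

theorem norm_jostTail_le (hq : HalfLineIntegrable q) (hk : 0 ≤ k.im) {x : ℝ} (hx : 0 ≤ x) :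
    ‖jostTail q k x‖ ≤
      Real.exp (-2 * k.im * x) * ((∫ t in Ioi 0, ‖q t‖) * Real.exp (momentTail q 0)) := by
  have integrable_norm : IntegrableOn (fun t => ‖jostSource q k t‖) (Ioi 0) :=
    (integrableOn_jostSource hq hk).norm
  calc ‖jostTail q k x‖ ≤ ∫ t in Ioi x, Real.exp (-2 * k.im * x) * ‖jostSource q k t‖ := by
        refine norm_integral_le_of_norm_le
          ((integrable_norm.mono_set (Ioi_subset_Ioi hx)).const_mul _)
          (ae_restrict_of_forall_mem measurableSet_Ioi fun t (ht : x < t) => ?_)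
        rw [norm_mul, norm_exp_two_I_mul]
        gcongr Real.exp ?_ * _
        linarith [mul_le_mul_of_nonneg_left ht.le hk]
    _ ≤ Real.exp (-2 * k.im * x) * ∫ t in Ioi 0, ‖jostSource q k t‖ := by
        rw [integral_const_mul]
        exact mul_le_mul_of_nonneg_left (setIntegral_mono_set integrable_norm
          (Eventually.of_forall fun _ => norm_nonneg _) (Ioi_subset_Ioi hx).eventuallyLE)
          (Real.exp_nonneg _)
    _ ≤ _ := mul_le_mul_of_nonneg_left (integral_norm_jostSource_le hq hk) (Real.exp_nonneg _)

theorem differentiableOn_jostTail_zero (hq : HalfLineIntegrable q) :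
    DifferentiableOn ℂ (fun k => jostTail q k 0) upperHalfPlaneSet := by
  refine differentiableOn_integral_of_norm_le isOpen_upperHalfPlaneSet
    (b := fun t => ‖q t‖ * Real.exp (momentTail q 0)) (hq.integrableOn.norm.mul_const _)
    (fun k hk => (integrableOn_exp_mul_jostSource hq (le_of_lt hk)).aestronglyMeasurable)
    (ae_restrict_of_forall_mem measurableSet_Ioi fun t ht => ?_)
    (ae_restrict_of_forall_mem measurableSet_Ioi fun t ht k hk => ?_)
  · exact DifferentiableOn.mul (by fun_prop)
      ((differentiableOn_jostReduced hq (le_of_lt ht)).const_mul _)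
  · rw [norm_mul]
    exact (mul_le_of_le_one_left (norm_nonneg _)
      (norm_exp_two_I_mul_le_one (le_of_lt hk) (le_of_lt ht))).trans
      (norm_jostSource_le hq (le_of_lt hk) (le_of_lt ht))

end Tails

section Equation

theorem isHalfLinePrimitive_exp_mul (c : ℂ) :
    IsHalfLinePrimitive (fun x : ℝ => exp (c * x)) (fun x => c * exp (c * x)) :=
  .of_hasDerivAt (fun x => by
    simpa [mul_comm] using ((hasDerivAt_id (x : ℂ)).const_mul c).cexp.comp_ofReal) (by fun_prop)

theorem isHalfLinePrimitive_jostKernel_neg (k : ℂ) :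
    IsHalfLinePrimitive (fun x : ℝ => jostKernel k (-x)) (fun x => -exp (-(2 * I * k) * x)) := by
  refine .of_hasDerivAt (fun x => ?_) (by fun_prop)
  simpa [Function.comp_def] using (hasDerivAt_jostKernel k (-x)).scomp x (hasDerivAt_neg x)

theorem isHalfLinePrimitive_jostReduced (hq : HalfLineIntegrable q) (hk : 0 ≤ k.im) :
    IsHalfLinePrimitive (jostReduced q k)
      (fun x => -(exp (-(2 * I * k) * x) * jostTail q k x)) := by
  have kernel_tail :=
    isHalfLinePrimitive_integral_Ioi (integrableOn_jostKernel_mul_jostSource hq hk)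
  have source_tail := isHalfLinePrimitive_integral_Ioi (integrableOn_jostSource hq hk)
  have one_primitive : IsHalfLinePrimitive (fun _ => (1 : ℂ)) fun _ => 0 :=
    .of_hasDerivAt (fun _ => hasDerivAt_const _ _) continuous_const
  refine ((one_primitive.add (((isHalfLinePrimitive_exp_mul _).mul kernel_tail).add
    ((isHalfLinePrimitive_jostKernel_neg k).mul source_tail))).congr_left fun x hx =>
      (jostReduced_eq_tails hq hk hx).symm).congr fun x hx => ?_
  have kernel_neg : jostKernel k (-x) = -(exp (-(2 * I * k) * x) * jostKernel k x) := by
    have h := jostKernel_sub k x x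
    rw [sub_self, show jostKernel k 0 = 0 by simp [jostKernel], ← neg_mul] at h
    linear_combination -h
  rw [jostTail_eq hq hk hx.le, kernel_neg]
  ring

theorem isHalfLinePrimitive_jost (hq : HalfLineIntegrable q) (hk : 0 ≤ k.im) :
    IsHalfLinePrimitive (jost q k) (jostDeriv q k) := by
  refine ((isHalfLinePrimitive_exp_mul (I * k)).mul
    (isHalfLinePrimitive_jostReduced hq hk)).congr fun x _ => ?_
  have exp_eq : exp (-(I * k) * x) = exp (I * k * x) * exp (-(2 * I * k) * x) := by
    rw [← Complex.exp_add]
    ring_nf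
  rw [jostDeriv, jost, exp_eq]
  ring

theorem isHalfLinePrimitive_jostDeriv (hq : HalfLineIntegrable q) (hk : 0 ≤ k.im) :
    IsHalfLinePrimitive (jostDeriv q k) (fun t => (q t - k ^ 2) * jost q k t) := by
  have tail := isHalfLinePrimitive_integral_Ioi (integrableOn_exp_mul_jostSource hq hk)
  refine (((isHalfLinePrimitive_jost hq hk).const_mul (I * k)).sub
    ((isHalfLinePrimitive_exp_mul (-(I * k))).mul tail)).congr fun x _ => ?_
  have exp_eq : exp (I * k * x) = exp (-(I * k) * x) * exp (2 * I * k * x) := by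
    rw [← Complex.exp_add]
    ring_nf
  rw [jostDeriv, jostTail, jostSource, jost, exp_eq]
  linear_combination (exp (-(I * k) * x) * exp (2 * I * k * x) * jostReduced q k x * k ^ 2) *
    Complex.I_sq

theorem jost_zero : jost q k 0 = jostReduced q k 0 := by simp [jost]

theorem jostDeriv_zero : jostDeriv q k 0 = I * k * jostReduced q k 0 - jostTail q k 0 := by
  simp [jostDeriv, jost]

theorem norm_jost_le (hq : HalfLineIntegrable q) (hk : 0 ≤ k.im) {x : ℝ} (hx : 0 ≤ x) :
    ‖jost q k x‖ ≤ Real.exp (momentTail q 0) * Real.exp (-k.im * x) := by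
  rw [jost, norm_mul, norm_exp_I_mul, mul_comm]
  exact mul_le_mul_of_nonneg_right (norm_jostReduced_le_const hq hk hx) (Real.exp_nonneg _)

theorem norm_jostDeriv_le (hq : HalfLineIntegrable q) (hk : 0 ≤ k.im) {x : ℝ} (hx : 0 ≤ x) :
    ‖jostDeriv q k x‖ ≤
      (‖k‖ + ∫ t in Ioi 0, ‖q t‖) * Real.exp (momentTail q 0) * Real.exp (-k.im * x) := by
  have norm_exp_neg : ‖exp (-(I * k) * x)‖ = Real.exp (k.im * x) := by simp [Complex.norm_exp]
  have exp_mul_exp : Real.exp (k.im * x) * Real.exp (-2 * k.im * x) = Real.exp (-k.im * x) := by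
    rw [← Real.exp_add]
    ring_nf
  calc ‖jostDeriv q k x‖
      ≤ ‖k‖ * ‖jost q k x‖ + Real.exp (k.im * x) * ‖jostTail q k x‖ := by
        rw [jostDeriv]
        refine (norm_sub_le _ _).trans_eq ?_
        rw [norm_mul, norm_mul, norm_mul, Complex.norm_I, one_mul, norm_exp_neg]
    _ ≤ ‖k‖ * (Real.exp (momentTail q 0) * Real.exp (-k.im * x)) + Real.exp (k.im * x) *
          (Real.exp (-2 * k.im * x) *
            ((∫ t in Ioi 0, ‖q t‖) * Real.exp (momentTail q 0))) := by
        gcongr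
        exacts [norm_jost_le hq hk hx, norm_jostTail_le hq hk hx]
    _ = _ := by
        rw [← mul_assoc (Real.exp (k.im * x)), exp_mul_exp]
        ring

theorem tendsto_jostReduced_atTop (hq : HalfLineIntegrable q) (hk : 0 ≤ k.im) :
    Tendsto (jostReduced q k) atTop (𝓝 1) := by
  have bound_tendsto : Tendsto (fun x => Real.exp (momentTail q x) - 1) atTop (𝓝 0) := by
    simpa [momentTail] using
      ((Real.continuous_exp.tendsto 0).comp
        (tendsto_integral_Ioi_zero hq.integrableOn_moment)).sub_const 1
  exact tendsto_sub_nhds_zero_iff.1 <| squeeze_zero_norm' ((eventually_ge_atTop 0).mono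
    fun x hx => norm_jostReduced_sub_one_le hq hk hx) bound_tendsto

theorem jost_cauchyData_ne_zero (hq : HalfLineIntegrable q) (hk : 0 ≤ k.im) :
    ¬ (jost q k 0 = 0 ∧ jostDeriv q k 0 = 0) := by
  rintro ⟨jost_eq_zero, deriv_eq_zero⟩
  have reduced_eq_zero (x : ℝ) (hx : 0 ≤ x) : jostReduced q k x = 0 := by
    have h := (cauchyData_eq_zero_unique (isHalfLinePrimitive_jost hq hk)
      (isHalfLinePrimitive_jostDeriv hq hk)
      (fun x hx => (hq.intervalIntegrable hx).sub intervalIntegrable_const)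
      jost_eq_zero deriv_eq_zero hx).1
    exact (mul_eq_zero.1 h).resolve_left (Complex.exp_ne_zero _)
  refine zero_ne_one (tendsto_nhds_unique (tendsto_const_nhds.congr' ?_)
    (tendsto_jostReduced_atTop hq hk))
  filter_upwards [eventually_ge_atTop 0] with x hx using (reduced_eq_zero x hx).symm

end Equation

end Schrodinger

/-! ### Wronskians at infinity -/

section WronskianAtInfinity

variable {u v f g r : ℝ → ℂ} {C : ℝ}

theorem frequently_norm_le_one_of_integrableOn_sq (hu : IntegrableOn (fun t => ‖u t‖ ^ 2) (Ioi 0)) :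
    ∃ᶠ t in atTop, ‖u t‖ ≤ 1 := by
  intro eventually_gt
  obtain ⟨a, ha⟩ := eventually_atTop.1 (eventually_gt.and (eventually_ge_atTop 0))
  have one_integrable : IntegrableOn (fun _ : ℝ => (1 : ℝ)) (Ioi a) :=
    (hu.mono_set (Ioi_subset_Ioi (ha a le_rfl).2)).mono' aestronglyMeasurable_const
      (ae_restrict_of_forall_mem measurableSet_Ioi fun t (ht : a < t) => by
        simpa using (not_le.1 (ha t ht.le).1).le)
  simp [integrableOn_const_iff] at one_integrable

theorem norm_integral_mul_le_of_integrableOn_sq (hu2 : IntegrableOn (fun t => ‖u t‖ ^ 2) (Ioi 0))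
    {δ : ℝ} (hδ : 0 < δ) {a b : ℝ} (ha : 0 ≤ a) (hab : a ≤ b) (hu : ContinuousOn u (uIcc a b))
    (hgC : ∀ t, 0 ≤ t → ‖g t‖ ≤ C) :
    ‖∫ t in a..b, u t * g t‖ ≤ C * (δ * (b - a) + (∫ t in Ioi 0, ‖u t‖ ^ 2) / δ) := by
  have hC : 0 ≤ C := (norm_nonneg _).trans (hgC 0 le_rfl)
  have u2_integrable : IntervalIntegrable (fun t => ‖u t‖ ^ 2) volume a b :=
    (hu.norm.pow 2).intervalIntegrable
  have norm_le (t : ℝ) : ‖u t‖ ≤ δ + ‖u t‖ ^ 2 / δ := by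
    rw [← sub_le_iff_le_add', le_div_iff₀ hδ]
    nlinarith [sq_nonneg (‖u t‖ - δ), norm_nonneg (u t)]
  calc ‖∫ t in a..b, u t * g t‖ ≤ ∫ t in a..b, C * (δ + ‖u t‖ ^ 2 / δ) := by
        refine intervalIntegral.norm_integral_le_of_norm_le hab
          (Eventually.of_forall fun t ht => ?_)
          ((intervalIntegrable_const.add (u2_integrable.div_const δ)).const_mul C)
        rw [norm_mul, mul_comm]
        exact mul_le_mul (hgC t (ha.trans ht.1.le)) (norm_le t) (norm_nonneg _) hC
    _ = C * (δ * (b - a) + (∫ t in a..b, ‖u t‖ ^ 2) / δ) := by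
        rw [intervalIntegral.integral_const_mul,
          intervalIntegral.integral_add intervalIntegrable_const (u2_integrable.div_const δ),
          intervalIntegral.integral_div, intervalIntegral.integral_const, smul_eq_mul, mul_comm δ]
    _ ≤ _ := by
        gcongr
        rw [intervalIntegral.integral_of_le hab]
        exact setIntegral_mono_set hu2 (Eventually.of_forall fun _ => by positivity)
          (show Ioc a b ⊆ Ioi 0 from fun t ht => ha.trans_lt ht.1).eventuallyLE

theorem norm_integral_wronskian_le (hu : IsHalfLinePrimitive u v)
    (hu2 : IntegrableOn (fun t => ‖u t‖ ^ 2) (Ioi 0)) (hf : IsHalfLinePrimitive f g)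
    (hfC : ∀ t, 0 ≤ t → ‖f t‖ ≤ C) (hgC : ∀ t, 0 ≤ t → ‖g t‖ ≤ C) {δ : ℝ} (hδ : 0 < δ)
    {a b : ℝ} (ha : 0 ≤ a) (hab : a ≤ b) :
    ‖∫ t in a..b, (u t * g t - v t * f t)‖ ≤
      2 * (C * (δ * (b - a) + (∫ t in Ioi 0, ‖u t‖ ^ 2) / δ)) + C * (‖u b‖ + ‖u a‖) := by
  have hb : 0 ≤ b := ha.trans hab
  have restrict {h : ℝ → ℂ} (hh : ∀ x, 0 ≤ x → IntervalIntegrable h volume 0 x) :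
      IntervalIntegrable h volume a b := (hh a ha).symm.trans (hh b hb)
  have ug_integrable : IntervalIntegrable (fun t => u t * g t) volume a b :=
    (restrict fun x hx => (hf x hx).1).continuousOn_mul (hu.continuousOn_uIcc ha hb)
  have vf_integrable : IntervalIntegrable (fun t => v t * f t) volume a b :=
    (restrict fun x hx => (hu x hx).1).mul_continuousOn (hf.continuousOn_uIcc ha hb)
  have parts : ∫ t in a..b, (u t * g t - v t * f t) =
      2 * (∫ t in a..b, u t * g t) - (u b * f b - u a * f a) := by
    rw [(hu.mul hf).sub_eq_integral ha hb, ← intervalIntegral.integral_const_mul,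
      ← intervalIntegral.integral_sub (ug_integrable.const_mul 2)
        (vf_integrable.add ug_integrable)]
    congr 1 with t
    ring
  rw [parts]
  refine (norm_sub_le _ _).trans (add_le_add ?_ ((norm_sub_le _ _).trans ?_))
  · simpa using
      norm_integral_mul_le_of_integrableOn_sq hu2 hδ ha hab (hu.continuousOn_uIcc ha hb) hgC
  · rw [norm_mul, norm_mul, mul_add, mul_comm ‖u b‖, mul_comm ‖u a‖]
    gcongr
    exacts [hfC b hb, hfC a ha]

theorem eq_zero_of_frequently_norm_integral_le {w : ℝ → ℂ} {L : ℂ} (hw : ContinuousOn w (Ici 0))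
    (hL : Tendsto w atTop (𝓝 L))
    (hle : ∀ ε > 0, ∀ a ≥ 0, ∃ K : ℝ, ∃ᶠ b in atTop, ‖∫ t in a..b, w t‖ ≤ ε * (b - a) + K) :
    L = 0 := by
  by_contra hL0
  set ε := ‖L‖ / 4 with ε_def
  have hε : 0 < ε := by positivity
  obtain ⟨a, ha⟩ := eventually_atTop.1
    ((hL.eventually (Metric.closedBall_mem_nhds L hε)).and (eventually_ge_atTop 0))
  have ha0 : 0 ≤ a := (ha a le_rfl).2
  obtain ⟨K, hK⟩ := hle ε hε a ha0
  obtain ⟨b, hbK, hb⟩ := (hK.and_eventually (eventually_gt_atTop (max a (a + K / ε)))).exists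
  obtain ⟨hab, hKb⟩ := max_lt_iff.1 hb
  have integral_sub_eq :
      ∫ t in a..b, (w t - L) = (∫ t in a..b, w t) - ((b - a : ℝ) : ℂ) * L := by
    rw [intervalIntegral.integral_sub
      (hw.mono fun t ht => (le_min ha0 (ha0.trans hab.le)).trans ht.1).intervalIntegrable
      intervalIntegrable_const, intervalIntegral.integral_const, Complex.real_smul]
  have norm_integral_sub_le : ‖∫ t in a..b, (w t - L)‖ ≤ ε * (b - a) := by
    rw [← abs_of_pos (sub_pos.2 hab)]
    refine intervalIntegral.norm_integral_le_of_norm_le_const fun t ht => ?_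
    exact mem_closedBall_iff_norm.1 (ha t (uIoc_of_le hab.le ▸ ht).1.le).1
  have norm_le := norm_sub_le (∫ t in a..b, w t) (∫ t in a..b, (w t - L))
  rw [integral_sub_eq, sub_sub_cancel, norm_mul, Complex.norm_of_nonneg (sub_pos.2 hab).le,
    ← integral_sub_eq] at norm_le
  have lt_mul : K < ε * (b - a) := (div_lt_iff₀' hε).1 (lt_sub_iff_add_lt'.2 hKb)
  nlinarith

theorem wronskian_zero_eq_integral (hu : IsHalfLinePrimitive u v)
    (hu2 : IntegrableOn (fun t => ‖u t‖ ^ 2) (Ioi 0)) (hf : IsHalfLinePrimitive f g)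
    (hfC : ∀ t, 0 ≤ t → ‖f t‖ ≤ C) (hgC : ∀ t, 0 ≤ t → ‖g t‖ ≤ C)
    (hW : IsHalfLinePrimitive (fun t => u t * g t - v t * f t) fun t => -r t)
    (hr : IntegrableOn r (Ioi 0)) :
    u 0 * g 0 - v 0 * f 0 = ∫ t in Ioi 0, r t := by
  have hC : 0 ≤ C := (norm_nonneg _).trans (hfC 0 le_rfl)
  have wronskian_eq (t : ℝ) (ht : 0 ≤ t) : u 0 * g 0 - v 0 * f 0 - (∫ t in Ioi 0, r t) +
      ∫ s in Ioi t, r s = u t * g t - v t * f t := by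
    have h := (hW t ht).2
    rw [intervalIntegral.integral_neg] at h
    rw [setIntegral_Ioi_eq_sub hr ht]
    linear_combination -h
  refine sub_eq_zero.1 (eq_zero_of_frequently_norm_integral_le hW.continuousOn ?_
    fun ε hε a ha => ?_)
  · have hlim := (tendsto_integral_Ioi_zero hr).const_add
      (u 0 * g 0 - v 0 * f 0 - ∫ t in Ioi 0, r t)
    rw [add_zero] at hlim
    refine hlim.congr' ?_
    filter_upwards [eventually_ge_atTop 0] with t ht using wronskian_eq t ht
  · obtain ⟨δ, hδ, hδε⟩ : ∃ δ > 0, 2 * C * δ ≤ ε :=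
      ⟨ε / (2 * C + 1), by positivity, by
        rw [mul_div_assoc', div_le_iff₀ (by positivity)]
        nlinarith⟩
    refine ⟨2 * (C * ((∫ t in Ioi 0, ‖u t‖ ^ 2) / δ)) + C * (1 + ‖u a‖),
      ((frequently_norm_le_one_of_integrableOn_sq hu2).and_eventually
        (eventually_ge_atTop a)).mono fun b ⟨hub, hab⟩ => ?_⟩
    have bound := norm_integral_wronskian_le hu hu2 hf hfC hgC hδ ha hab
    nlinarith [mul_le_mul_of_nonneg_left hub hC,
      mul_le_mul_of_nonneg_right hδε (sub_nonneg.2 hab)]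

end WronskianAtInfinity

/-! ### The Wronskian of the two Jost solutions -/

namespace Schrodinger

/-- The reflected potential, by which the left half-line is treated as a right half-line. -/
def refl (q : ℝ → ℂ) (x : ℝ) : ℂ := q (-x)

/-- The Wronskian at `0` of the Jost solutions at `-∞` and `+∞`. The first of them is
`x ↦ jost (refl q) k (-x)`, which explains the sign of the second term. -/
noncomputable def jostWronskian (q : ℝ → ℂ) (k : ℂ) : ℂ :=
  jost (refl q) k 0 * jostDeriv q k 0 + jostDeriv (refl q) k 0 * jost q k 0

/-- The potential has a finite first moment on the whole line. -/
structure LineIntegrable (q : ℝ → ℂ) : Prop where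
  integrable : Integrable q
  integrable_moment : Integrable fun t => |t| * ‖q t‖

namespace LineIntegrable

variable {q : ℝ → ℂ}

theorem of_weight (hq : AEStronglyMeasurable q volume)
    (hint : Integrable (fun x : ℝ => (1 + |x|) * ‖q x‖) volume) : LineIntegrable q where
  integrable := hint.mono' hq (Eventually.of_forall fun x => by
    nlinarith [mul_nonneg (abs_nonneg x) (norm_nonneg (q x))])
  integrable_moment := hint.mono' (continuous_abs.aestronglyMeasurable.mul hq.norm)
    (Eventually.of_forall fun x => by
      rw [Real.norm_of_nonneg (by positivity)]
      nlinarith [norm_nonneg (q x)])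

theorem refl (hq : LineIntegrable q) : LineIntegrable (refl q) where
  integrable := hq.integrable.comp_neg
  integrable_moment := by simpa [Schrodinger.refl] using hq.integrable_moment.comp_neg

theorem halfLine (hq : LineIntegrable q) : HalfLineIntegrable q :=
  ⟨hq.integrable.integrableOn, hq.integrable_moment.integrableOn⟩

end LineIntegrable

variable {p q : ℝ → ℂ} {k : ℂ}

theorem jost_mul_jostDeriv_add (hq : HalfLineIntegrable q) (hp : HalfLineIntegrable p)
    (hk : 0 ≤ k.im) :
    jost p k 0 * jostDeriv q k 0 + jostDeriv p k 0 * jost q k 0 = 2 * I * k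
      - (∫ t in Ioi 0, jostSource q k t) - (∫ t in Ioi 0, jostSource p k t)
      - (jostReduced p k 0 - 1) * (∫ t in Ioi 0, jostSource q k t)
      - (jostReduced q k 0 - 1) * jostTail p k 0 := by
  have hq0 := two_I_mul_jostReduced_zero_sub_one hq hk
  have hp0 := two_I_mul_jostReduced_zero_sub_one hp hk
  rw [jost_zero, jost_zero, jostDeriv_zero, jostDeriv_zero]
  linear_combination hq0 * jostReduced p k 0 + hp0

theorem norm_jost_mul_jostDeriv_add_sub_le (hq : HalfLineIntegrable q)
    (hp : HalfLineIntegrable p) (hk : 0 ≤ k.im) :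
    ‖jost p k 0 * jostDeriv q k 0 + jostDeriv p k 0 * jost q k 0 - 2 * I * k
      + ((∫ t in Ioi 0, q t) + ∫ t in Ioi 0, p t)‖ ≤
      ((∫ t in Ioi 0, ‖q t‖) + ∫ t in Ioi 0, ‖p t‖) *
        (Real.exp (momentTail q 0 + momentTail p 0) - 1) := by
  have source_q := norm_integral_jostSource_sub_le hq hk
  have source_p := norm_integral_jostSource_sub_le hp hk
  have product_q := norm_mul_le_of_le (norm_jostReduced_sub_one_le hp hk le_rfl)
    ((norm_integral_le_integral_norm _).trans (integral_norm_jostSource_le hq hk))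
  have product_p := norm_mul_le_of_le (norm_jostReduced_sub_one_le hq hk le_rfl)
    (norm_jostTail_le hp hk le_rfl)
  have decomposition :
      jost p k 0 * jostDeriv q k 0 + jostDeriv p k 0 * jost q k 0 - 2 * I * k
        + ((∫ t in Ioi 0, q t) + ∫ t in Ioi 0, p t) =
      -(((∫ t in Ioi 0, jostSource q k t) - ∫ t in Ioi 0, q t)
        + ((∫ t in Ioi 0, jostSource p k t) - ∫ t in Ioi 0, p t)
        + (jostReduced p k 0 - 1) * (∫ t in Ioi 0, jostSource q k t)
        + (jostReduced q k 0 - 1) * jostTail p k 0) := by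
    rw [jost_mul_jostDeriv_add hq hp hk]
    ring
  rw [decomposition, norm_neg, Real.exp_add]
  refine (norm_add_le_of_le (norm_add_le_of_le (norm_add_le_of_le source_q source_p) product_q)
    product_p).trans (le_of_eq ?_)
  simp only [mul_zero, Real.exp_zero, one_mul]
  ring

theorem differentiableOn_jost_zero (hq : HalfLineIntegrable q) :
    DifferentiableOn ℂ (fun k => jost q k 0) upperHalfPlaneSet := by
  simpa only [jost_zero] using differentiableOn_jostReduced hq le_rfl

theorem differentiableOn_jostDeriv_zero (hq : HalfLineIntegrable q) :
    DifferentiableOn ℂ (fun k => jostDeriv q k 0) upperHalfPlaneSet := by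
  simp only [jostDeriv_zero]
  exact (DifferentiableOn.mul (by fun_prop) (differentiableOn_jostReduced hq le_rfl)).sub
    (differentiableOn_jostTail_zero hq)

theorem differentiableOn_jostWronskian (hq : LineIntegrable q) :
    DifferentiableOn ℂ (jostWronskian q) upperHalfPlaneSet :=
  ((differentiableOn_jost_zero hq.refl.halfLine).mul
    (differentiableOn_jostDeriv_zero hq.halfLine)).add
    ((differentiableOn_jostDeriv_zero hq.refl.halfLine).mul
      (differentiableOn_jost_zero hq.halfLine))

theorem setIntegral_Ioi_add_comp_neg {E : Type*} [NormedAddCommGroup E] [NormedSpace ℝ E]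
    {f : ℝ → E} (hf : Integrable f) :
    (∫ t in Ioi (0 : ℝ), f t) + ∫ t in Ioi (0 : ℝ), f (-t) = ∫ t, f t := by
  rw [integral_comp_neg_Ioi, neg_zero, add_comm, ← compl_Iic,
    integral_add_compl measurableSet_Iic hf]

theorem norm_jostWronskian_sub_le (hq : LineIntegrable q) (hk : 0 ≤ k.im) :
    ‖jostWronskian q k - 2 * I * k + ∫ t, q t‖ ≤ constA q := by
  have moment_add : momentTail q 0 + momentTail (refl q) 0 = norm1 q := by
    simpa [momentTail, norm1, refl] using setIntegral_Ioi_add_comp_neg hq.integrable_moment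
  have bound := norm_jost_mul_jostDeriv_add_sub_le hq.halfLine hq.refl.halfLine hk
  rw [moment_add] at bound
  simp only [refl, setIntegral_Ioi_add_comp_neg hq.integrable,
    setIntegral_Ioi_add_comp_neg hq.integrable.norm] at bound
  have exp_sub_one_le : Real.exp (norm1 q) - 1 ≤ norm1 q * Real.exp (norm1 q) := by
    have h := mul_le_mul_of_nonneg_right (Real.one_sub_le_exp_neg (norm1 q))
      (Real.exp_nonneg (norm1 q))
    rw [← Real.exp_add, neg_add_cancel, Real.exp_zero] at h
    linarith
  rw [constA, norm0, mul_assoc (∫ x, ‖q x‖)]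
  exact bound.trans
    (mul_le_mul_of_nonneg_left exp_sub_one_le (integral_nonneg fun _ => norm_nonneg _))

end Schrodinger

/-! ### Bounded holomorphic functions on the upper half-plane -/

theorem sub_conj_ne_zero {z κ : ℂ} (hz : 0 < z.im) (hκ : 0 < κ.im) : z - conj κ ≠ 0 := fun h => by
  have him := congrArg Complex.im h
  simp only [Complex.sub_im, Complex.conj_im, Complex.zero_im] at him
  linarith

theorem add_I_ne_zero {z : ℂ} (hz : 0 < z.im) : z + I ≠ 0 := by
  simpa using sub_conj_ne_zero (κ := I) hz (by rw [Complex.I_im]; exact one_pos)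

theorem norm_le_norm_add_I {z : ℂ} (hz : 0 ≤ z.im) : ‖z‖ ≤ ‖z + I‖ := by
  refine Real.sqrt_le_sqrt ?_
  simp only [Complex.normSq_apply, Complex.add_re, Complex.add_im, Complex.I_re, Complex.I_im]
  linarith

theorem closedBall_subset_upperHalfPlaneSet {c : ℂ} {r : ℝ} (hr : r < c.im) :
    Metric.closedBall c r ⊆ upperHalfPlaneSet := by
  intro z hz
  have him := (abs_le.1 ((Complex.abs_im_le_norm (z - c)).trans (mem_closedBall_iff_norm.1 hz))).1
  rw [Complex.sub_im] at him
  exact show 0 < z.im by linarith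

theorem norm_sub_sq_eq_norm_sub_conj_sq (z κ : ℂ) :
    ‖z - κ‖ ^ 2 = ‖z - conj κ‖ ^ 2 - 4 * z.im * κ.im := by
  simp only [← Complex.normSq_eq_norm_sq, Complex.normSq_apply, Complex.sub_re, Complex.sub_im,
    Complex.conj_re, Complex.conj_im]
  ring

/-- The Blaschke factor of the upper half-plane with zero at `κ`; its modulus is the
pseudo-hyperbolic distance from `z` to `κ`. -/
noncomputable def blaschkeFactor (κ z : ℂ) : ℂ := (z - κ) / (z - conj κ)

theorem blaschkeFactor_self (κ : ℂ) : blaschkeFactor κ κ = 0 := by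
  rw [blaschkeFactor, sub_self, zero_div]

theorem blaschkeFactor_eq_zero_iff {κ z : ℂ} (hκ : 0 < κ.im) (hz : 0 < z.im) :
    blaschkeFactor κ z = 0 ↔ z = κ := by
  rw [blaschkeFactor, div_eq_zero_iff, sub_eq_zero, or_iff_left (sub_conj_ne_zero hz hκ)]

theorem norm_blaschkeFactor_lt_one {κ z : ℂ} (hκ : 0 < κ.im) (hz : 0 < z.im) :
    ‖blaschkeFactor κ z‖ < 1 := by
  rw [blaschkeFactor, norm_div, div_lt_one (norm_pos_iff.2 (sub_conj_ne_zero hz hκ))]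
  refine lt_of_pow_lt_pow_left₀ 2 (norm_nonneg _) ?_
  rw [norm_sub_sq_eq_norm_sub_conj_sq]
  linarith [mul_pos hz hκ]

theorem differentiableOn_blaschkeFactor {κ : ℂ} (hκ : 0 < κ.im) :
    DifferentiableOn ℂ (blaschkeFactor κ) upperHalfPlaneSet :=
  DifferentiableOn.div (by fun_prop) (by fun_prop) fun _ hz => sub_conj_ne_zero hz hκ

theorem im_pos_of_norm_sub_le {κ z : ℂ} {s : ℝ} (hκ : 0 < κ.im) (hs0 : 0 ≤ s) (hs1 : s < 1)
    (h : ‖z - κ‖ ≤ s * ‖z - conj κ‖) : 0 < z.im := by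
  by_contra! hz
  have hsq := norm_sub_sq_eq_norm_sub_conj_sq z κ
  have hle : ‖z - κ‖ ^ 2 ≤ s ^ 2 * ‖z - conj κ‖ ^ 2 := by
    rw [← mul_pow]
    exact pow_le_pow_left₀ (norm_nonneg _) h 2
  have hconj : ‖z - conj κ‖ = 0 := by
    by_contra hne
    have hpos : 0 < ‖z - conj κ‖ ^ 2 := by positivity
    have hs2 : s ^ 2 < 1 := pow_lt_one₀ hs0 hs1 two_ne_zero
    nlinarith [mul_nonneg (neg_nonneg.2 hz) hκ.le, mul_lt_of_lt_one_left hpos hs2]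
  have hz_eq : z = κ := by
    rw [hconj, mul_zero] at h
    exact sub_eq_zero.1 (norm_le_zero_iff.1 h)
  rw [← hz_eq] at hκ
  exact hz.not_gt hκ

theorem isBounded_setOf_norm_sub_lt {s : ℝ} (hs0 : 0 ≤ s) (hs1 : s < 1) (κ : ℂ) :
    Bornology.IsBounded {z : ℂ | ‖z - κ‖ < s * ‖z - conj κ‖} := by
  refine (Metric.isBounded_closedBall (x := κ) (r := s * ‖κ - conj κ‖ / (1 - s))).subset
    fun z hz => ?_
  have htri : ‖z - conj κ‖ ≤ ‖z - κ‖ + ‖κ - conj κ‖ := norm_sub_le_norm_sub_add_norm_sub ..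
  rw [mem_closedBall_iff_norm, le_div_iff₀ (sub_pos.2 hs1)]
  linarith [mem_ofPred.1 hz, mul_le_mul_of_nonneg_left htri hs0]

-- The maximum principle on the pseudo-hyperbolic discs of radius `s` about `κ`; then `s → 1`.
theorem norm_sub_conj_mul_dslope_le {κ : ℂ} (hκ : 0 < κ.im) {f : ℂ → ℂ} {M : ℝ}
    (hd : DifferentiableOn ℂ f upperHalfPlaneSet) (hfκ : f κ = 0)
    (hM : ∀ z : ℂ, 0 < z.im → ‖f z‖ ≤ M) {z : ℂ} (hz : 0 < z.im) :
    ‖(z - conj κ) * dslope f κ z‖ ≤ M := by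
  have hf : ∀ w, f w = (w - κ) * dslope f κ w := fun w => by
    rw [← smul_eq_mul, sub_smul_dslope, hfκ, sub_zero]
  have hgd : DifferentiableOn ℂ (fun w => (w - conj κ) * dslope f κ w) upperHalfPlaneSet :=
    DifferentiableOn.mul (by fun_prop)
      ((Complex.differentiableOn_dslope (isOpen_upperHalfPlaneSet.mem_nhds hκ)).2 hd)
  have hpos : 0 < ‖z - conj κ‖ := norm_pos_iff.2 (sub_conj_ne_zero hz hκ)
  have hdisc : ∀ s : ℝ, ‖blaschkeFactor κ z‖ < s → s < 1 →
      s * ‖(z - conj κ) * dslope f κ z‖ ≤ M := fun s hs hs1 => by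
    have hs0 : 0 < s := (norm_nonneg _).trans_lt hs
    have hcont : Continuous fun w : ℂ => ‖w - κ‖ := by fun_prop
    have hcont' : Continuous fun w : ℂ => s * ‖w - conj κ‖ := by fun_prop
    have hclosure : closure {w : ℂ | ‖w - κ‖ < s * ‖w - conj κ‖} ⊆ upperHalfPlaneSet :=
      fun w hw => im_pos_of_norm_sub_le hκ hs0.le hs1 (closure_lt_subset_le hcont hcont' hw)
    have hfrontier : ∀ w ∈ frontier {w : ℂ | ‖w - κ‖ < s * ‖w - conj κ‖},
        ‖(w - conj κ) * dslope f κ w‖ ≤ M / s := fun w hw => by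
      have heq : ‖w - κ‖ = s * ‖w - conj κ‖ := frontier_lt_subset_eq hcont hcont' hw
      rw [le_div_iff₀' hs0, norm_mul, ← mul_assoc, ← heq, ← norm_mul, ← hf]
      exact hM w (hclosure (frontier_subset_closure hw))
    rw [blaschkeFactor, norm_div, div_lt_iff₀ hpos] at hs
    rw [← le_div_iff₀' hs0]
    exact Complex.norm_le_of_forall_mem_frontier_norm_le (isBounded_setOf_norm_sub_lt hs0.le hs1 κ)
      (hgd.mono hclosure).diffContOnCl hfrontier (subset_closure hs)
  have hlim : Tendsto (fun s : ℝ => s * ‖(z - conj κ) * dslope f κ z‖) (𝓝[<] 1)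
      (𝓝 (1 * ‖(z - conj κ) * dslope f κ z‖)) :=
    (tendsto_nhdsWithin_of_tendsto_nhds tendsto_id).mul_const _
  rw [one_mul] at hlim
  refine le_of_tendsto hlim ?_
  filter_upwards [Ioo_mem_nhdsLT (norm_blaschkeFactor_lt_one hκ hz)] with s hs
  exact hdisc s hs.1 hs.2

theorem norm_le_mul_norm_blaschkeFactor {κ : ℂ} (hκ : 0 < κ.im) {f : ℂ → ℂ} {M : ℝ}
    (hd : DifferentiableOn ℂ f upperHalfPlaneSet) (hfκ : f κ = 0)
    (hM : ∀ z : ℂ, 0 < z.im → ‖f z‖ ≤ M) {z : ℂ} (hz : 0 < z.im) :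
    ‖f z‖ ≤ M * ‖blaschkeFactor κ z‖ := by
  have hpos : 0 < ‖z - conj κ‖ := norm_pos_iff.2 (sub_conj_ne_zero hz hκ)
  have hf : f z = (z - κ) * dslope f κ z := by
    rw [← smul_eq_mul, sub_smul_dslope, hfκ, sub_zero]
  have hle := norm_sub_conj_mul_dslope_le hκ hd hfκ hM hz
  rw [norm_mul] at hle
  rw [hf, blaschkeFactor, norm_mul, norm_div, ← mul_div_assoc, le_div_iff₀ hpos]
  nlinarith [norm_nonneg (z - κ)]

theorem count_le_analyticOrderAt_sub_conj_mul_dslope {κ : ℂ} (hκ : 0 < κ.im) {f : ℂ → ℂ}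
    (hd : DifferentiableOn ℂ f upperHalfPlaneSet) (hfκ : f κ = 0) (l : Multiset ℂ) {w : ℂ}
    (hw : 0 < w.im) (hord : ((κ ::ₘ l).count w : ℕ∞) ≤ analyticOrderAt f w) :
    (l.count w : ℕ∞) ≤ analyticOrderAt (fun z => (z - conj κ) * dslope f κ z) w := by
  have hfac : f = (fun z => z - κ) * dslope f κ := funext fun z => by
    rw [Pi.mul_apply, ← smul_eq_mul, sub_smul_dslope, hfκ, sub_zero]
  have hdslope : AnalyticAt ℂ (dslope f κ) w :=
    ((Complex.differentiableOn_dslope (isOpen_upperHalfPlaneSet.mem_nhds hκ)).2 hd).analyticAt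
      (isOpen_upperHalfPlaneSet.mem_nhds hw)
  have hunit : analyticOrderAt (fun z : ℂ => z - conj κ) w = 0 :=
    AnalyticAt.analyticOrderAt_eq_zero (by fun_prop) |>.2 (sub_conj_ne_zero hw hκ)
  have hgoal : analyticOrderAt (fun z => (z - conj κ) * dslope f κ z) w =
      analyticOrderAt (dslope f κ) w := by
    rw [← zero_add (analyticOrderAt (dslope f κ) w), ← hunit]
    exact analyticOrderAt_mul (by fun_prop) hdslope
  rw [hgoal]
  rw [hfac, analyticOrderAt_mul (by fun_prop) hdslope] at hord
  rcases eq_or_ne w κ with rfl | hne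
  · rw [Multiset.count_cons_self, analyticOrderAt_id_sub_const_self, Nat.cast_succ,
      add_comm] at hord
    exact (WithTop.add_le_add_iff_left ENat.one_ne_top).1 hord
  · rwa [Multiset.count_cons_of_ne hne, analyticOrderAt_id_sub_const_of_ne hne, zero_add] at hord

theorem norm_le_mul_prod_norm_blaschkeFactor (l : Multiset ℂ) (hl : ∀ κ ∈ l, 0 < κ.im)
    {f : ℂ → ℂ} {M : ℝ} (hd : DifferentiableOn ℂ f upperHalfPlaneSet)
    (hM : ∀ z : ℂ, 0 < z.im → ‖f z‖ ≤ M)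
    (hord : ∀ κ ∈ l, (l.count κ : ℕ∞) ≤ analyticOrderAt f κ) {z : ℂ} (hz : 0 < z.im) :
    ‖f z‖ ≤ M * (l.map fun κ => ‖blaschkeFactor κ z‖).prod := by
  induction l using Multiset.induction_on generalizing f with
  | empty => simpa using hM z hz
  | cons κ l ih =>
    have hκ : 0 < κ.im := hl κ (Multiset.mem_cons_self κ l)
    have hfκ : f κ = 0 := by
      refine apply_eq_zero_of_analyticOrderAt_ne_zero (ne_bot_of_le_ne_bot ?_
        (hord κ (Multiset.mem_cons_self κ l)))
      rw [Multiset.count_cons_self]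
      exact Nat.cast_ne_zero.2 (Nat.succ_ne_zero _)
    have hgd : DifferentiableOn ℂ (fun w => (w - conj κ) * dslope f κ w) upperHalfPlaneSet :=
      DifferentiableOn.mul (by fun_prop)
        ((Complex.differentiableOn_dslope (isOpen_upperHalfPlaneSet.mem_nhds hκ)).2 hd)
    have hquot := ih (fun w hw => hl w (Multiset.mem_cons_of_mem hw)) hgd
      (fun w hw => norm_sub_conj_mul_dslope_le hκ hd hfκ hM hw) fun w hw =>
        count_le_analyticOrderAt_sub_conj_mul_dslope hκ hd hfκ l
          (hl w (Multiset.mem_cons_of_mem hw)) (hord w (Multiset.mem_cons_of_mem hw))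
    have hf : f z = blaschkeFactor κ z * ((z - conj κ) * dslope f κ z) := by
      rw [blaschkeFactor, ← mul_assoc, div_mul_cancel₀ _ (sub_conj_ne_zero hz hκ), ← smul_eq_mul,
        sub_smul_dslope, hfκ, sub_zero]
    rw [Multiset.map_cons, Multiset.prod_cons, hf, norm_mul, mul_left_comm]
    exact mul_le_mul_of_nonneg_left hquot (norm_nonneg _)

/-! ### Fixed points of holomorphic maps into a compact subset of the upper half-plane -/

section FixedPoint

variable {φ : ℂ → ℂ} {K : Set ℂ}

theorem exists_lt_one_norm_blaschkeFactor_le (hK : IsCompact K) (hKU : K ⊆ upperHalfPlaneSet)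
    {κ : ℂ} (hκ : 0 < κ.im) : ∃ s < 1, ∀ z ∈ K, ‖blaschkeFactor κ z‖ ≤ s := by
  rcases K.eq_empty_or_nonempty with rfl | hne
  · exact ⟨0, one_pos, fun z hz => hz.elim⟩
  · obtain ⟨w, hwK, hmax⟩ := hK.exists_isMaxOn hne
      ((differentiableOn_blaschkeFactor hκ).continuousOn.mono hKU).norm
    exact ⟨‖blaschkeFactor κ w‖, norm_blaschkeFactor_lt_one hκ (hKU hwK), hmax⟩

theorem differentiableOn_blaschkeFactor_comp (hφ : DifferentiableOn ℂ φ upperHalfPlaneSet)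
    (hmaps : MapsTo φ upperHalfPlaneSet upperHalfPlaneSet) {κ : ℂ} (hκ : 0 < κ.im) :
    DifferentiableOn ℂ (fun z => blaschkeFactor κ (φ z)) upperHalfPlaneSet :=
  (differentiableOn_blaschkeFactor hκ).comp hφ hmaps

theorem exists_lt_one_norm_blaschkeFactor_map_le (hφ : DifferentiableOn ℂ φ upperHalfPlaneSet)
    (hK : IsCompact K) (hKU : K ⊆ upperHalfPlaneSet) (hmaps : MapsTo φ upperHalfPlaneSet K)
    {w : ℂ} (hw : 0 < w.im) :
    ∃ s < 1, ∀ z : ℂ, 0 < z.im →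
      ‖blaschkeFactor (φ w) (φ z)‖ ≤ s * ‖blaschkeFactor w z‖ := by
  have hφw : 0 < (φ w).im := hKU (hmaps hw)
  obtain ⟨s, hs1, hs⟩ := exists_lt_one_norm_blaschkeFactor_le hK hKU hφw
  exact ⟨s, hs1, fun z hz => norm_le_mul_norm_blaschkeFactor hw
    (differentiableOn_blaschkeFactor_comp hφ (hmaps.mono_right hKU) hφw)
    (blaschkeFactor_self _) (fun _ hz' => hs _ (hmaps hz')) hz⟩

-- Edelstein's argument: `φ` strictly decreases the pseudo-hyperbolic distance from `z` to `φ z`,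
-- so this distance vanishes where it is minimal on `K`.
theorem exists_fixedPoint_of_mapsTo_compact (hφ : DifferentiableOn ℂ φ upperHalfPlaneSet)
    (hK : IsCompact K) (hKU : K ⊆ upperHalfPlaneSet) (hmaps : MapsTo φ upperHalfPlaneSet K) :
    ∃ a ∈ K, φ a = a := by
  have hcont : ContinuousOn (fun z => ‖blaschkeFactor z (φ z)‖) K := by
    have hφc : ContinuousOn φ K := hφ.continuousOn.mono hKU
    refine ((hφc.sub continuousOn_id).div
      (hφc.sub Complex.continuous_conj.continuousOn) fun z hz => ?_).norm
    exact sub_conj_ne_zero (hKU (hmaps (hKU hz))) (hKU hz)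
  obtain ⟨a, haK, hmin⟩ := hK.exists_isMinOn ⟨φ I, hmaps (by simp)⟩ hcont
  refine ⟨a, haK, ?_⟩
  by_contra hne
  have ha : 0 < a.im := hKU haK
  have hφaK : φ a ∈ K := hmaps ha
  obtain ⟨s, hs1, hs⟩ := exists_lt_one_norm_blaschkeFactor_map_le hφ hK hKU hmaps ha
  have hpos : 0 < ‖blaschkeFactor a (φ a)‖ :=
    norm_pos_iff.2 fun h => hne ((blaschkeFactor_eq_zero_iff ha (hKU hφaK)).1 h)
  exact (((hmin hφaK).trans (hs _ (hKU hφaK))).trans_lt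
    (mul_lt_of_lt_one_left hpos hs1)).false

theorem fixedPoint_unique_of_mapsTo_compact (hφ : DifferentiableOn ℂ φ upperHalfPlaneSet)
    (hK : IsCompact K) (hKU : K ⊆ upperHalfPlaneSet) (hmaps : MapsTo φ upperHalfPlaneSet K)
    {a b : ℂ} (ha : 0 < a.im) (hb : 0 < b.im) (hφa : φ a = a) (hφb : φ b = b) : b = a := by
  obtain ⟨s, hs1, hs⟩ := exists_lt_one_norm_blaschkeFactor_map_le hφ hK hKU hmaps ha
  have hcontr := hs b hb
  rw [hφa, hφb] at hcontr
  by_contra hne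
  have hpos : 0 < ‖blaschkeFactor a b‖ :=
    norm_pos_iff.2 fun h => hne ((blaschkeFactor_eq_zero_iff ha hb).1 h)
  exact (hcontr.trans_lt (mul_lt_of_lt_one_left hpos hs1)).false

theorem norm_deriv_fixedPoint_lt_one (hφ : DifferentiableOn ℂ φ upperHalfPlaneSet)
    (hK : IsCompact K) (hKU : K ⊆ upperHalfPlaneSet) (hmaps : MapsTo φ upperHalfPlaneSet K)
    {a : ℂ} (ha : 0 < a.im) (hφa : φ a = a) : ‖deriv φ a‖ < 1 := by
  obtain ⟨s, hs1, hs⟩ := exists_lt_one_norm_blaschkeFactor_le hK hKU ha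
  have hne : a - conj a ≠ 0 := sub_conj_ne_zero ha ha
  have hzero : blaschkeFactor a (φ a) = 0 := by rw [hφa, blaschkeFactor_self]
  have hderiv : HasDerivAt (fun z => blaschkeFactor a (φ z)) (deriv φ a / (a - conj a)) a := by
    have hφ' : HasDerivAt φ (deriv φ a) a :=
      (hφ.differentiableAt (isOpen_upperHalfPlaneSet.mem_nhds ha)).hasDerivAt
    refine ((hφ'.sub_const a).div (hφ'.sub_const (conj a)) (by rwa [hφa])).congr_deriv ?_
    rw [hφa]
    field_simp
    ring
  have hle := norm_sub_conj_mul_dslope_le ha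
    (differentiableOn_blaschkeFactor_comp hφ (hmaps.mono_right hKU) ha) hzero
    (fun z hz => hs _ (hmaps hz)) ha
  rw [dslope_same, hderiv.deriv, mul_div_cancel₀ _ hne] at hle
  exact hle.trans_lt hs1

end FixedPoint

/-! ### Blaschke products -/

theorem summable_one_sub_of_le_prod {ι : Type*} {a : ι → ℝ} {δ : ℝ} (hδ : 0 < δ)
    (ha : ∀ i, a i ≤ 1) (hprod : ∀ s : Finset ι, δ ≤ ∏ i ∈ s, a i) :
    Summable fun i => 1 - a i := by
  have hpos : ∀ i, 0 < a i := fun i => hδ.trans_le (by simpa using hprod {i})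
  refine summable_of_sum_le (c := -Real.log δ) (fun i => sub_nonneg.2 (ha i)) fun s => ?_
  have hexp : δ ≤ Real.exp (-∑ i ∈ s, (1 - a i)) := by
    rw [← Finset.sum_neg_distrib, Real.exp_sum]
    refine (hprod s).trans (Finset.prod_le_prod (fun i _ => (hpos i).le) fun i _ => ?_)
    linarith [Real.add_one_le_exp (-(1 - a i))]
  linarith [(Real.log_le_iff_le_exp hδ).2 hexp]

theorem im_le_mul_one_sub_norm_blaschkeFactor {κ z : ℂ} (hκ : 0 < κ.im) (hz : 0 < z.im) :
    κ.im ≤ ‖z - conj κ‖ ^ 2 / (2 * z.im) * (1 - ‖blaschkeFactor κ z‖) := by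
  have hne : ‖z - conj κ‖ ≠ 0 := norm_ne_zero_iff.2 (sub_conj_ne_zero hz hκ)
  have hsq : ‖z - conj κ‖ ^ 2 * (1 - ‖blaschkeFactor κ z‖ ^ 2) = 4 * z.im * κ.im := by
    rw [blaschkeFactor, norm_div, div_pow, mul_sub, mul_div_cancel₀ _ (pow_ne_zero 2 hne),
      norm_sub_sq_eq_norm_sub_conj_sq z κ]
    ring
  rw [div_mul_eq_mul_div, le_div_iff₀ (by positivity)]
  nlinarith [mul_nonneg (sq_nonneg ‖z - conj κ‖) (sq_nonneg (1 - ‖blaschkeFactor κ z‖))]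

theorem norm_blaschkeFactor_sub_one_le {κ z : ℂ} {η : ℝ} (hκ : 0 < κ.im) (hη : 0 < η)
    (hz : η ≤ z.im) : ‖blaschkeFactor κ z - 1‖ ≤ 2 / η * κ.im := by
  have hnum : ‖conj κ - κ‖ = 2 * κ.im := by
    rw [norm_sub_rev, Complex.sub_conj, norm_mul, Complex.norm_I, mul_one, Complex.norm_real,
      Real.norm_of_nonneg (by positivity)]
  have hden : η ≤ ‖z - conj κ‖ := by
    refine le_trans ?_ (Complex.im_le_norm _)
    rw [Complex.sub_im, Complex.conj_im]
    linarith
  rw [blaschkeFactor, div_sub_one (sub_conj_ne_zero (hη.trans_le hz) hκ), sub_sub_sub_cancel_left,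
    norm_div, hnum, div_mul_eq_mul_div]
  gcongr

section BlaschkeProduct

variable {ι : Type*} {κ : ι → ℂ} {z : ℂ}

theorem norm_le_mul_finsetProd_norm_blaschkeFactor (hκ : ∀ i, 0 < (κ i).im) {f : ℂ → ℂ} {M : ℝ}
    (hd : DifferentiableOn ℂ f upperHalfPlaneSet) (hM : ∀ w : ℂ, 0 < w.im → ‖f w‖ ≤ M)
    (hord : ∀ w : ℂ, 0 < w.im → (κ ⁻¹' {w}).encard ≤ analyticOrderAt f w) (hz : 0 < z.im)
    (s : Finset ι) : ‖f z‖ ≤ M * ∏ i ∈ s, ‖blaschkeFactor (κ i) z‖ := by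
  classical
  have hl : ∀ w ∈ s.val.map κ, 0 < w.im := fun w hw => by
    obtain ⟨i, -, rfl⟩ := Multiset.mem_map.1 hw
    exact hκ i
  have hcount : ∀ w, ((s.val.map κ).count w : ℕ∞) ≤ (κ ⁻¹' {w}).encard := fun w => by
    rw [Multiset.count_map, ← Finset.filter_val, Finset.card_val,
      ← Set.encard_coe_eq_coe_finsetCard]
    exact encard_le_encard fun i hi => (Finset.mem_filter.1 hi).2.symm
  have hle := norm_le_mul_prod_norm_blaschkeFactor (s.val.map κ) hl hd hM
    (fun w hw => (hcount w).trans (hord w (hl w hw))) hz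
  rwa [Multiset.map_map] at hle

theorem summable_im_of_encard_le_analyticOrderAt (hκ : ∀ i, 0 < (κ i).im) {R : ℝ}
    (hR : ∀ i, ‖κ i‖ ≤ R) {f : ℂ → ℂ} {M : ℝ} (hd : DifferentiableOn ℂ f upperHalfPlaneSet)
    (hM : ∀ w : ℂ, 0 < w.im → ‖f w‖ ≤ M)
    (hord : ∀ w : ℂ, 0 < w.im → (κ ⁻¹' {w}).encard ≤ analyticOrderAt f w) (hz : 0 < z.im)
    (hfz : f z ≠ 0) : Summable fun i => (κ i).im := by
  have hpos : 0 < ‖f z‖ := norm_pos_iff.2 hfz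
  have hM0 : 0 < M := hpos.trans_le (hM z hz)
  have hsum : Summable fun i => 1 - ‖blaschkeFactor (κ i) z‖ :=
    summable_one_sub_of_le_prod (div_pos hpos hM0)
      (fun i => (norm_blaschkeFactor_lt_one (hκ i) hz).le) fun s => by
        rw [div_le_iff₀' hM0]
        exact norm_le_mul_finsetProd_norm_blaschkeFactor hκ hd hM hord hz s
  refine Summable.of_nonneg_of_le (fun i => (hκ i).le) (fun i => ?_)
    (hsum.mul_left ((‖z‖ + R) ^ 2 / (2 * z.im)))
  have hle : ‖z - conj (κ i)‖ ≤ ‖z‖ + R :=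
    (norm_sub_le _ _).trans (by rw [Complex.norm_conj]; linarith [hR i])
  refine (im_le_mul_one_sub_norm_blaschkeFactor (hκ i) hz).trans ?_
  have := sub_nonneg.2 (norm_blaschkeFactor_lt_one (hκ i) hz).le
  gcongr

theorem summable_norm_blaschkeFactor_sub_one (hκ : ∀ i, 0 < (κ i).im)
    (hsum : Summable fun i => (κ i).im) (hz : 0 < z.im) :
    Summable fun i => ‖blaschkeFactor (κ i) z - 1‖ :=
  (hsum.mul_left (2 / z.im)).of_nonneg_of_le (fun _ => norm_nonneg _)
    fun i => norm_blaschkeFactor_sub_one_le (hκ i) hz le_rfl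

theorem norm_tprod_blaschkeFactor_le_one (hκ : ∀ i, 0 < (κ i).im)
    (hsum : Summable fun i => (κ i).im) (hz : 0 < z.im) :
    ‖∏' i, blaschkeFactor (κ i) z‖ ≤ 1 := by
  have hmul : Multipliable fun i => blaschkeFactor (κ i) z := by
    simpa only [add_sub_cancel] using
      multipliable_one_add_of_summable (summable_norm_blaschkeFactor_sub_one hκ hsum hz)
  exact le_of_tendsto hmul.hasProd.norm <| Eventually.of_forall fun s =>
    Finset.prod_le_one (fun _ _ => norm_nonneg _) fun i _ =>
      (norm_blaschkeFactor_lt_one (hκ i) hz).le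

theorem differentiableOn_tprod_blaschkeFactor (hκ : ∀ i, 0 < (κ i).im)
    (hsum : Summable fun i => (κ i).im) :
    DifferentiableOn ℂ (fun z => ∏' i, blaschkeFactor (κ i) z) upperHalfPlaneSet := fun z hz => by
  have hz0 : 0 < z.im := hz
  set U : Set ℂ := {w | z.im / 2 < w.im}
  have hUo : IsOpen U := isOpen_lt continuous_const Complex.continuous_im
  have hzU : z ∈ U := half_lt_self hz0
  have hη : 0 < z.im / 2 := half_pos hz0
  have hfactor : ∀ i, DifferentiableOn ℂ (blaschkeFactor (κ i)) U := fun i =>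
    (differentiableOn_blaschkeFactor (hκ i)).mono fun _ hw => hη.trans hw
  have hprod := Summable.hasProdLocallyUniformlyOn_one_add
    (f := fun i w => blaschkeFactor (κ i) w - 1) hUo (hsum.mul_left (2 / (z.im / 2)))
    (Eventually.of_forall fun i w hw => norm_blaschkeFactor_sub_one_le (hκ i) hη (le_of_lt hw))
    fun i => ((hfactor i).sub_const 1).continuousOn
  simp only [add_sub_cancel] at hprod
  have hdiff : DifferentiableOn ℂ (fun w => ∏' i, blaschkeFactor (κ i) w) U :=
    hprod.differentiableOn (Eventually.of_forall fun s =>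
      DifferentiableOn.fun_finsetProd fun i _ => hfactor i) hUo
  exact (hdiff.differentiableAt (hUo.mem_nhds hzU)).differentiableWithinAt

end BlaschkeProduct

theorem isBigO_of_isBigO_mul {X : Type*} [TopologicalSpace X] {f g : X → ℂ} {φ : X → ℂ} {a : X}
    (hg : ContinuousAt g a) (hga : g a ≠ 0) (h : (fun x => f x * g x) =O[𝓝 a] φ) :
    f =O[𝓝 a] φ := by
  have hinv : (fun x => (g x)⁻¹) =O[𝓝 a] fun _ => (1 : ℂ) :=
    (hg.inv₀ hga).tendsto.isBigO_one ℂ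
  have hprod := h.mul hinv
  simp only [mul_one] at hprod
  refine hprod.congr' ?_ EventuallyEq.rfl
  filter_upwards [hg.eventually_ne hga] with x hx
  exact mul_inv_cancel_right₀ hx _

-- Cramer's rule for the linear system with unknowns `y`, `z`.
theorem isBigO_det_of_isBigO_linear {X : Type*} [TopologicalSpace X] {a b c d y z φ : X → ℂ}
    {x₀ : X} (ha : ContinuousAt a x₀) (hb : ContinuousAt b x₀) (hc : ContinuousAt c x₀)
    (hd : ContinuousAt d x₀) (hy : ContinuousAt y x₀) (hz : ContinuousAt z x₀)
    (hne : y x₀ ≠ 0 ∨ z x₀ ≠ 0) (h₁ : (fun x => y x * b x - z x * a x) =O[𝓝 x₀] φ)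
    (h₂ : (fun x => y x * d x + z x * c x) =O[𝓝 x₀] φ) :
    (fun x => c x * b x + d x * a x) =O[𝓝 x₀] φ := by
  have mul_isBigO {f g : X → ℂ} (hf : ContinuousAt f x₀) (hg : g =O[𝓝 x₀] φ) :
      (fun x => f x * g x) =O[𝓝 x₀] φ := by
    simpa only [one_mul] using (hf.tendsto.isBigO_one ℂ).mul hg
  rcases hne with hne | hne
  · exact isBigO_of_isBigO_mul hy hne
      (((mul_isBigO hc h₁).add (mul_isBigO ha h₂)).congr_left fun x => by ring)
  · exact isBigO_of_isBigO_mul hz hne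
      (((mul_isBigO hb h₂).sub (mul_isBigO hd h₁)).congr_left fun x => by ring)

theorem natCast_le_analyticOrderAt_of_isBigO {f : ℂ → ℂ} {z₀ : ℂ} {n : ℕ} (hf : AnalyticAt ℂ f z₀)
    (h : f =O[𝓝 z₀] fun z => (z - z₀) ^ n) : (n : ℕ∞) ≤ analyticOrderAt f z₀ := by
  by_contra! hlt
  obtain ⟨m, hm⟩ := ENat.ne_top_iff_exists.1 (ne_top_of_lt hlt)
  rw [← hm, Nat.cast_lt] at hlt
  obtain ⟨g, hg, hg0, hfg⟩ := hf.analyticOrderAt_eq_natCast.1 hm.symm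
  have hpow : (fun z => (z - z₀) ^ m) =O[𝓝 z₀] fun z => (z - z₀) ^ n :=
    isBigO_of_isBigO_mul hg.continuousAt hg0 (h.congr' hfg EventuallyEq.rfl)
  have hlittle : (fun z => (z - z₀) ^ n) =o[𝓝 z₀] fun z => (z - z₀) ^ m := by
    simpa only [← norm_pow, Asymptotics.isLittleO_norm_norm] using
      Asymptotics.isLittleO_pow_sub_pow_sub z₀ hlt
  refine Asymptotics.isLittleO_irrefl ?_ (hpow.trans_isLittleO hlittle)
  have hne : ∀ᶠ z in 𝓝[≠] z₀, (z - z₀) ^ m ≠ 0 := by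
    filter_upwards [self_mem_nhdsWithin] with z hz
    exact pow_ne_zero _ (sub_ne_zero.2 hz)
  exact hne.frequently.filter_mono nhdsWithin_le_nhds

namespace Schrodinger

variable {q u v g : ℝ → ℂ} {k E : ℂ}

/-! ### Solutions and chains of generalized eigenfunctions -/

/-- On `[0, ∞)` the function `u` has the derivative `v`, and `-u'' + q u = g`. -/
structure IsHalfLineSolution (q u v g : ℝ → ℂ) : Prop where
  primitive : IsHalfLinePrimitive u v
  primitive_deriv : IsHalfLinePrimitive v fun t => q t * u t - g t

namespace IsHalfLineSolution

variable {u₁ v₁ g₁ u₂ v₂ g₂ : ℝ → ℂ}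

theorem congr_ae {g' : ℝ → ℂ} (h : IsHalfLineSolution q u v g) (hg : ∀ᵐ t, 0 < t → g t = g' t) :
    IsHalfLineSolution q u v g' where
  primitive := h.primitive
  primitive_deriv := h.primitive_deriv.congr_ae
    (by filter_upwards [hg] with t ht ht0 using by rw [ht ht0])

theorem add (h₁ : IsHalfLineSolution q u₁ v₁ g₁) (h₂ : IsHalfLineSolution q u₂ v₂ g₂) :
    IsHalfLineSolution q (fun t => u₁ t + u₂ t) (fun t => v₁ t + v₂ t)
      (fun t => g₁ t + g₂ t) where
  primitive := h₁.primitive.add h₂.primitive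
  primitive_deriv := (h₁.primitive_deriv.add h₂.primitive_deriv).congr fun t _ => by ring

theorem const_mul (c : ℂ) (h : IsHalfLineSolution q u v g) :
    IsHalfLineSolution q (fun t => c * u t) (fun t => c * v t) (fun t => c * g t) where
  primitive := h.primitive.const_mul c
  primitive_deriv := (h.primitive_deriv.const_mul c).congr fun t _ => by ring

theorem eq_zero (hq : HalfLineIntegrable q) (h : IsHalfLineSolution q u v fun t => E * u t)
    (hu : u 0 = 0) (hv : v 0 = 0) {x : ℝ} (hx : 0 ≤ x) : u x = 0 :=
  (cauchyData_eq_zero_unique (r := fun t => q t - E) h.primitive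
    (h.primitive_deriv.congr fun t _ => by ring)
    (fun _ hx => (hq.intervalIntegrable hx).sub intervalIntegrable_const) hu hv hx).1

theorem wronskian (hq : HalfLineIntegrable q) (hk : 0 ≤ k.im) (h : IsHalfLineSolution q u v g)
    (hu : IntegrableOn (fun t => ‖u t‖ ^ 2) (Ioi 0))
    (hint : IntegrableOn (fun t => (k ^ 2 * u t - g t) * jost q k t) (Ioi 0)) :
    u 0 * jostDeriv q k 0 - v 0 * jost q k 0 =
      ∫ t in Ioi 0, (k ^ 2 * u t - g t) * jost q k t := by
  have hexp (t : ℝ) (ht : 0 ≤ t) : Real.exp (-k.im * t) ≤ 1 :=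
    Real.exp_le_one_iff.2 (mul_nonpos_of_nonpos_of_nonneg (neg_nonpos.2 hk) ht)
  have hJ : 0 ≤ ∫ t in Ioi 0, ‖q t‖ := integral_nonneg fun _ => norm_nonneg _
  refine wronskian_zero_eq_integral
    (C := (1 + ‖k‖ + ∫ t in Ioi 0, ‖q t‖) * Real.exp (momentTail q 0)) h.primitive hu
    (isHalfLinePrimitive_jost hq hk) (fun t ht => ?_) (fun t ht => ?_) ?_ hint
  · refine (norm_jost_le hq hk ht).trans ?_
    rw [mul_comm]
    exact mul_le_mul_of_nonneg_right ((hexp t ht).trans (by linarith [norm_nonneg k]))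
      (Real.exp_nonneg _)
  · refine (norm_jostDeriv_le hq hk ht).trans ((mul_le_of_le_one_right (by positivity)
      (hexp t ht)).trans ?_)
    gcongr
    linarith
  · exact ((h.primitive.mul (isHalfLinePrimitive_jostDeriv hq hk)).sub
      (h.primitive_deriv.mul (isHalfLinePrimitive_jost hq hk))).congr fun t _ => by ring

end IsHalfLineSolution

/-- The function `u ∈ L²(ℝ)` has the derivative `v` and satisfies `-u'' + q u = g` on both
half-lines, the left one being reflected to `[0, ∞)`. -/
structure IsSolution (q u v g : ℝ → ℂ) : Prop where
  memLp : MemLp u 2 volume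
  right : IsHalfLineSolution q u v g
  left : IsHalfLineSolution (refl q) (fun t => u (-t)) (fun t => -v (-t)) fun t => g (-t)

theorem IsPair.exists_isSolution {y g : L2} (h : IsPair q y g) :
    ∃ u v : ℝ → ℂ, (y : ℝ → ℂ) =ᵐ[volume] u ∧ IsSolution q u v g := by
  obtain ⟨u, v, hy, hu, hi, hv⟩ := h
  have hv_cont : Continuous v := continuous_of_sub_eq_integral hi hv
  have hv_right : IsHalfLinePrimitive v fun t => q t * u t - g t := fun x _ =>
    ⟨hi 0 x, by rw [← hv 0 x, add_sub_cancel]⟩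
  have hv_left : IsHalfLinePrimitive (fun t => -v (-t)) fun t => refl q t * u (-t) - g (-t) := by
    refine fun x _ => ⟨?_, ?_⟩
    · simpa [refl] using (hi 0 (-x)).comp_sub_left (c := 0)
    · have hneg := intervalIntegral.integral_comp_neg (a := 0) (b := x)
        (fun t => q t * u t - g t)
      simp only [refl]
      rw [hneg, neg_zero, ← hv]
      ring
  have hu_neg (t : ℝ) : HasDerivAt (fun t => u (-t)) (-v (-t)) t := by
    simpa [Function.comp_def] using (hu (-t)).scomp t (hasDerivAt_neg t)
  exact ⟨u, v, hy, (memLp_congr_ae hy).1 (Lp.memLp y), ⟨.of_hasDerivAt hu hv_cont, hv_right⟩,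
    ⟨.of_hasDerivAt hu_neg (by fun_prop), hv_left⟩⟩

namespace IsSolution

variable {u₁ v₁ g₁ u₂ v₂ g₂ : ℝ → ℂ}

theorem congr {g' : ℝ → ℂ} (h : IsSolution q u v g) (hg : g =ᵐ[volume] g') :
    IsSolution q u v g' where
  memLp := h.memLp
  right := h.right.congr_ae (hg.mono fun _ ht _ => ht)
  left := h.left.congr_ae (((Measure.measurePreserving_neg
    (volume : Measure ℝ)).quasiMeasurePreserving.ae hg).mono fun _ ht _ => ht)

theorem reflect (h : IsSolution q u v g) :
    IsSolution (refl q) (fun t => u (-t)) (fun t => -v (-t)) (fun t => g (-t)) where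
  memLp := h.memLp.comp_measurePreserving (Measure.measurePreserving_neg (volume : Measure ℝ))
  right := h.left
  left := by
    have hrefl : refl (refl q) = q := funext fun t => congrArg q (neg_neg t)
    simpa only [hrefl, neg_neg] using h.right

theorem integrableOn_sq (h : IsSolution q u v g) : IntegrableOn (fun t => ‖u t‖ ^ 2) (Ioi 0) :=
  ((memLp_two_iff_integrable_sq_norm h.memLp.1).1 h.memLp).integrableOn

theorem add (h₁ : IsSolution q u₁ v₁ g₁) (h₂ : IsSolution q u₂ v₂ g₂) :
    IsSolution q (fun t => u₁ t + u₂ t) (fun t => v₁ t + v₂ t) (fun t => g₁ t + g₂ t) where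
  memLp := h₁.memLp.add h₂.memLp
  right := h₁.right.add h₂.right
  left := by simpa only [neg_add] using h₁.left.add h₂.left

theorem const_mul (c : ℂ) (h : IsSolution q u v g) :
    IsSolution q (fun t => c * u t) (fun t => c * v t) (fun t => c * g t) where
  memLp := h.memLp.const_mul c
  right := h.right.const_mul c
  left := by simpa only [mul_neg] using h.left.const_mul c

theorem eq_zero (hq : LineIntegrable q) (h : IsSolution q u v fun t => E * u t)
    (hu : u 0 = 0) (hv : v 0 = 0) : u = 0 := by
  ext x
  rcases le_total 0 x with hx | hx
  · exact h.right.eq_zero hq.halfLine hu hv hx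
  · simpa using h.left.eq_zero hq.refl.halfLine (by simpa using hu) (by simpa using hv)
      (neg_nonneg.2 hx)

theorem wronskian_eq_zero (hq : LineIntegrable q) (hk : 0 ≤ k.im)
    (h : IsSolution q u v fun t => k ^ 2 * u t) :
    u 0 * jostDeriv q k 0 - v 0 * jost q k 0 = 0 := by
  simpa using h.right.wronskian hq.halfLine hk h.integrableOn_sq (by simp)

end IsSolution

/-- The partial sum `∑_{j ≤ m} εʲ aⱼ`, which for a chain of generalized eigenfunctions is an
eigenfunction for the shifted spectral parameter up to `O(εᵐ⁺¹)`. -/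
noncomputable def powerSum (m : ℕ) (a : ℕ → ℂ) (ε : ℂ) : ℂ :=
  ∑ j ∈ Finset.range (m + 1), ε ^ j * a j

theorem powerSum_apply_zero (m : ℕ) (a : ℕ → ℂ) : powerSum m a 0 = a 0 := by
  simp [powerSum, Finset.sum_range_succ']

theorem powerSum_neg (m : ℕ) (a : ℕ → ℂ) (ε : ℂ) :
    powerSum m (fun j => -a j) ε = -powerSum m a ε := by
  simp [powerSum]

theorem continuous_powerSum (m : ℕ) (a : ℕ → ℂ) : Continuous (powerSum m a) := by
  unfold powerSum
  fun_prop

/-- A Jordan chain of `H` at `E`: `(H - E) u₀ = 0` and `(H - E) uⱼ₊₁ = uⱼ` for `j < m`. -/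
structure IsChain (q : ℝ → ℂ) (E : ℂ) (m : ℕ) (u v : ℕ → ℝ → ℂ) : Prop where
  zero : IsSolution q (u 0) (v 0) fun t => E * u 0 t
  succ : ∀ j < m, IsSolution q (u (j + 1)) (v (j + 1)) fun t => E * u (j + 1) t + u j t

namespace IsChain

variable {m : ℕ} {u v : ℕ → ℝ → ℂ}

theorem isSolution_powerSum (h : IsChain q E m u v) (ε : ℂ) :
    IsSolution q (fun t => powerSum m (u · t) ε) (fun t => powerSum m (v · t) ε)
      (fun t => (E + ε) * powerSum m (u · t) ε - ε ^ (m + 1) * u m t) := by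
  induction m with
  | zero =>
    convert h.zero using 2 with t t t <;> simp only [powerSum, zero_add, Finset.sum_range_one] <;>
      ring
  | succ m ih =>
    have hsum := (ih ⟨h.zero, fun j hj => h.succ j (by omega)⟩).add
      ((h.succ m (by omega)).const_mul (ε ^ (m + 1)))
    simp only [powerSum, Finset.sum_range_succ _ (m + 1)] at hsum ⊢
    convert hsum using 2 with t
    ring

theorem reflect (h : IsChain q E m u v) :
    IsChain (refl q) E m (fun j t => u j (-t)) (fun j t => -v j (-t)) :=
  ⟨h.zero.reflect, fun j hj => (h.succ j hj).reflect⟩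

theorem memLp (h : IsChain q E m u v) : MemLp (u m) 2 volume := by
  cases m with
  | zero => exact h.zero.memLp
  | succ m => exact (h.succ m (by omega)).memLp

end IsChain

theorem integrableOn_exp_neg {η : ℝ} (hη : 0 < η) :
    IntegrableOn (fun t : ℝ => Real.exp (-(2 * η) * t)) (Ioi 0) :=
  integrableOn_exp_mul_Ioi (by linarith) 0

theorem norm_jost_sq_le (hq : HalfLineIntegrable q) {η : ℝ} (hη : 0 < η) (hk : η ≤ k.im) {t : ℝ}
    (ht : 0 ≤ t) :
    ‖jost q k t‖ ^ 2 ≤ Real.exp (momentTail q 0) ^ 2 * Real.exp (-(2 * η) * t) := by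
  have hexp_sq : Real.exp (-(2 * η) * t) = Real.exp (-η * t) ^ 2 := by
    rw [← Real.exp_nat_mul]
    congr 1
    push_cast
    ring
  have hexp : Real.exp (-k.im * t) ≤ Real.exp (-η * t) := by gcongr
  rw [hexp_sq, ← mul_pow]
  exact pow_le_pow_left₀ (norm_nonneg _) ((norm_jost_le hq (hη.le.trans hk) ht).trans
    (mul_le_mul_of_nonneg_left hexp (Real.exp_nonneg _))) 2

theorem exists_norm_integral_mul_jost_le (hq : HalfLineIntegrable q) {η : ℝ} (hη : 0 < η)
    {w : ℝ → ℂ} (hw : MemLp w 2 (volume.restrict (Ioi 0))) :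
    ∃ C : ℝ, ∀ k : ℂ, η ≤ k.im → IntegrableOn (fun t => w t * jost q k t) (Ioi 0) ∧
      ‖∫ t in Ioi 0, w t * jost q k t‖ ≤ C := by
  set B : ℝ → ℝ := fun t =>
    ‖w t‖ ^ 2 + Real.exp (momentTail q 0) ^ 2 * Real.exp (-(2 * η) * t)
  have hBi : IntegrableOn B (Ioi 0) := ((memLp_two_iff_integrable_sq_norm hw.1).1 hw).add
    ((integrableOn_exp_neg hη).const_mul _)
  refine ⟨∫ t in Ioi 0, B t, fun k hk => ?_⟩
  have hle : ∀ᵐ t ∂(volume.restrict (Ioi (0 : ℝ))), ‖w t * jost q k t‖ ≤ B t :=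
    ae_restrict_of_forall_mem measurableSet_Ioi fun t ht => by
      have hsq := norm_jost_sq_le hq hη hk (le_of_lt ht)
      rw [norm_mul]
      nlinarith [two_mul_le_add_sq ‖w t‖ ‖jost q k t‖, sq_nonneg ‖w t‖, sq_nonneg ‖jost q k t‖]
  have hjost : AEStronglyMeasurable (jost q k) (volume.restrict (Ioi 0)) :=
    ((isHalfLinePrimitive_jost hq (hη.le.trans hk)).continuousOn.mono
      Ioi_subset_Ici_self).aestronglyMeasurable measurableSet_Ioi
  exact ⟨hBi.mono' (hw.1.mul hjost) hle, norm_integral_le_of_norm_le hBi hle⟩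

namespace IsChain

variable {κ : ℂ} {m : ℕ} {u v : ℕ → ℝ → ℂ}

theorem isBigO_wronskian (hq : LineIntegrable q) (hκ : 0 < κ.im) (h : IsChain q (κ ^ 2) m u v) :
    (fun k => powerSum m (u · 0) (k ^ 2 - κ ^ 2) * jostDeriv q k 0 -
      powerSum m (v · 0) (k ^ 2 - κ ^ 2) * jost q k 0) =O[𝓝 κ] fun k => (k - κ) ^ (m + 1) := by
  obtain ⟨C, hC⟩ := exists_norm_integral_mul_jost_le hq.halfLine (half_pos hκ) (h.memLp.restrict _)
  have hnhds : ∀ᶠ k in 𝓝 κ, κ.im / 2 ≤ k.im :=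
    (Complex.continuous_im.tendsto κ).eventually (eventually_ge_nhds (by linarith))
  have hfactor : (fun k => (k ^ 2 - κ ^ 2) ^ (m + 1)) =O[𝓝 κ] fun k => (k - κ) ^ (m + 1) := by
    have hsum : (fun k : ℂ => k + κ) =O[𝓝 κ] fun _ => (1 : ℂ) :=
      (Continuous.continuousAt (by fun_prop)).tendsto.isBigO_one ℂ
    refine Asymptotics.IsBigO.pow ?_ _
    simpa only [one_mul, ← sq_sub_sq] using hsum.mul (Asymptotics.isBigO_refl (· - κ) (𝓝 κ))
  refine Asymptotics.IsBigO.trans (Asymptotics.IsBigO.of_bound C ?_) hfactor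
  filter_upwards [hnhds] with k hk
  obtain ⟨hint, hnorm⟩ := hC k hk
  have hsol := h.isSolution_powerSum (k ^ 2 - κ ^ 2)
  have hsource (t : ℝ) : (k ^ 2 * powerSum m (u · t) (k ^ 2 - κ ^ 2) -
      ((κ ^ 2 + (k ^ 2 - κ ^ 2)) * powerSum m (u · t) (k ^ 2 - κ ^ 2) -
        (k ^ 2 - κ ^ 2) ^ (m + 1) * u m t)) * jost q k t =
      (k ^ 2 - κ ^ 2) ^ (m + 1) * (u m t * jost q k t) := by ring
  have hwronskian := hsol.right.wronskian hq.halfLine ((half_pos hκ).le.trans hk)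
    hsol.integrableOn_sq (by simp only [hsource]; exact hint.const_mul _)
  simp only [hsource] at hwronskian
  rw [hwronskian, integral_const_mul, norm_mul, mul_comm C]
  exact mul_le_mul_of_nonneg_left hnorm (norm_nonneg _)

theorem le_analyticOrderAt (hq : LineIntegrable q) (hκ : 0 < κ.im) (h : IsChain q (κ ^ 2) m u v)
    (h0 : u 0 ≠ 0) : ((m + 1 : ℕ) : ℕ∞) ≤ analyticOrderAt (jostWronskian q) κ := by
  have hmem := isOpen_upperHalfPlaneSet.mem_nhds hκ
  refine natCast_le_analyticOrderAt_of_isBigO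
    ((differentiableOn_jostWronskian hq).analyticAt hmem) ?_
  have hcont (a : ℕ → ℂ) : ContinuousAt (fun k => powerSum m a (k ^ 2 - κ ^ 2)) κ :=
    ((continuous_powerSum m a).comp (by fun_prop)).continuousAt
  have hreflect := h.reflect.isBigO_wronskian hq.refl hκ
  simp only [neg_zero, powerSum_neg, neg_mul, sub_neg_eq_add] at hreflect
  refine isBigO_det_of_isBigO_linear
    ((differentiableOn_jost_zero hq.halfLine).continuousOn.continuousAt hmem)
    ((differentiableOn_jostDeriv_zero hq.halfLine).continuousOn.continuousAt hmem)
    ((differentiableOn_jost_zero hq.refl.halfLine).continuousOn.continuousAt hmem)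
    ((differentiableOn_jostDeriv_zero hq.refl.halfLine).continuousOn.continuousAt hmem)
    (hcont (u · 0)) (hcont (v · 0)) ?_ (h.isBigO_wronskian hq hκ) hreflect
  simp only [sub_self, powerSum_apply_zero]
  by_contra! hzero
  exact h0 (h.zero.eq_zero hq hzero.1 hzero.2)

end IsChain

end Schrodinger

/-! ### Root spaces -/

theorem exists_eq_mul_of_det_eq_zero {K : Type*} [Field K] {a b x y : K}
    (h0 : ¬ (a = 0 ∧ b = 0)) (h : x * b - y * a = 0) : ∃ c, x = c * a ∧ y = c * b := by
  rcases not_and_or.1 h0 with ha | hb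
  · exact ⟨x / a, by field_simp, by field_simp; linear_combination -h⟩
  · exact ⟨y / b, by field_simp; linear_combination h, by field_simp⟩

namespace Schrodinger

section RootSpace

variable {X : Type*} [AddCommGroup X] [Module ℂ X] (T : X →ₗ.[ℂ] X) (E : ℂ)

theorem kerPow_succ_mono {m n : ℕ} (h : T.kerPow E m ≤ T.kerPow E n) :
    T.kerPow E (m + 1) ≤ T.kerPow E (n + 1) :=
  Submodule.map_mono (Submodule.comap_mono h)

theorem monotone_kerPow : Monotone (T.kerPow E) :=
  monotone_nat_of_le_succ fun n => by
    induction n with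
    | zero => exact bot_le
    | succ n ih => exact kerPow_succ_mono T E ih

theorem rootSpace_eq_kerPow {n : ℕ} (h : T.kerPow E (n + 1) ≤ T.kerPow E n) :
    T.rootSpace E = T.kerPow E n := by
  have hstep (m : ℕ) (hm : n ≤ m) : T.kerPow E (m + 1) ≤ T.kerPow E m := by
    induction m, hm using Nat.le_induction with
    | base => exact h
    | succ m _ ih => exact kerPow_succ_mono T E ih
  refine le_antisymm (iSup_le fun m => ?_) (le_iSup (T.kerPow E) n)
  rcases le_total m n with hm | hm
  · exact monotone_kerPow T E hm
  · induction m, hm using Nat.le_induction with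
    | base => exact le_rfl
    | succ m hm ih => exact (hstep m hm).trans ih

theorem rank_kerPow_le (n : ℕ) :
    Module.rank ℂ (T.kerPow E n) ≤ n * Module.rank ℂ (T.kerPow E 1) := by
  have hrank (n : ℕ) : Module.rank ℂ (T.kerPow E (n + 1)) =
      Module.rank ℂ ((T.kerPow E n).comap (T.toFun - E • T.domain.subtype)) :=
    rank_map_eq T.domain.subtype_injective _
  induction n with
  | zero => exact (rank_bot ℂ X).le.trans zero_le
  | succ n ih =>
    have hcomap := LinearMap.lift_rank_comap_le (f := T.toFun - E • T.domain.subtype)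
      (T.kerPow E n)
    simp only [Cardinal.lift_id] at hcomap
    rw [← hrank] at hcomap
    rw [Nat.cast_succ, add_one_mul]
    exact hcomap.trans (add_le_add ih (hrank 0).ge)

end RootSpace

section Eigenvectors

variable {q : ℝ → ℂ} {k E : ℂ} {y g : L2}

theorem isPair_H (z : (H q).domain) : IsPair q z (H q z) := by
  have h : ((z : L2), H q z) ∈ (H q).graph := LinearPMap.mem_graph _ z
  rwa [H_graph] at h

theorem IsPair.exists_domain (h : IsPair q y g) : ∃ z : (H q).domain, (z : L2) = y ∧ H q z = g :=
  (LinearPMap.mem_graph_iff (x := (y, g)) _).1 ((H_graph q).ge h)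

theorem isEigenvalue_iff : (H q).IsEigenvalue E ↔ ∃ y : L2, y ≠ 0 ∧ IsPair q y (E • y) := by
  constructor
  · rintro ⟨z, hz, h⟩
    exact ⟨z, hz, h ▸ isPair_H z⟩
  · rintro ⟨y, hy, h⟩
    obtain ⟨z, rfl, hz⟩ := h.exists_domain
    exact ⟨z, hy, hz⟩

theorem mem_kerPow_one : y ∈ (H q).kerPow E 1 ↔ IsPair q y (E • y) := by
  have hker (z : L2) : z ∈ (H q).kerPow E 0 ↔ z = 0 := Submodule.mem_bot ℂ
  rw [LinearPMap.mem_kerPow_succ]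
  simp only [hker, sub_eq_zero]
  constructor
  · rintro ⟨z, rfl, hz⟩
    exact hz ▸ isPair_H z
  · intro h
    obtain ⟨z, rfl, hz⟩ := h.exists_domain
    exact ⟨z, rfl, hz⟩

theorem IsPair.exists_isSolution_smul (h : IsPair q y (E • y)) :
    ∃ u v : ℝ → ℂ, (y : ℝ → ℂ) =ᵐ[volume] u ∧ IsSolution q u v fun t => E * u t := by
  obtain ⟨u, v, hy, hsol⟩ := h.exists_isSolution
  refine ⟨u, v, hy, hsol.congr ?_⟩
  filter_upwards [Lp.coeFn_smul E y, hy] with t hsmul hyt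
  rw [hsmul, Pi.smul_apply, hyt, smul_eq_mul]

theorem ne_zero_of_ae_eq {u : ℝ → ℂ} (h : (y : ℝ → ℂ) =ᵐ[volume] u) (hy : y ≠ 0) : u ≠ 0 := by
  rintro rfl
  exact hy (Lp.eq_zero_iff_ae_eq_zero.2 h)

theorem IsChain.snoc {m : ℕ} {u v : ℕ → ℝ → ℂ} {u' v' : ℝ → ℂ} (h : IsChain q E m u v)
    (h' : IsSolution q u' v' fun t => E * u' t + u m t) :
    IsChain q E (m + 1) (Function.update u (m + 1) u') (Function.update v (m + 1) v') where
  zero := by simpa using h.zero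
  succ j hj := by
    rcases Nat.lt_succ_iff_lt_or_eq.1 hj with hjm | rfl
    · have hne : j ≠ m := hjm.ne
      have hne' : j ≠ m + 1 := by omega
      simpa [hne, hne'] using h.succ j hjm
    · simpa using h'

theorem exists_isChain_of_mem_kerPow {m : ℕ} (hy : y ∈ (H q).kerPow E (m + 1))
    (hy' : y ∉ (H q).kerPow E m) :
    ∃ u v : ℕ → ℝ → ℂ, (y : ℝ → ℂ) =ᵐ[volume] u m ∧ u 0 ≠ 0 ∧ IsChain q E m u v := by
  induction m generalizing y with
  | zero =>
    obtain ⟨u, v, hu, hsol⟩ := (mem_kerPow_one.1 hy).exists_isSolution_smul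
    have hy0 : y ≠ 0 := fun h0 => hy' (h0 ▸ zero_mem _)
    exact ⟨fun _ => u, fun _ => v, hu, ne_zero_of_ae_eq hu hy0, hsol, by simp⟩
  | succ m ih =>
    obtain ⟨z, rfl, hz⟩ := (LinearPMap.mem_kerPow_succ _ _ _ _).1 hy
    have hz' : H q z - E • (z : L2) ∉ (H q).kerPow E m := fun h =>
      hy' ((LinearPMap.mem_kerPow_succ _ _ _ _).2 ⟨z, rfl, h⟩)
    obtain ⟨u, v, hum, hu0, hchain⟩ := ih hz hz'
    obtain ⟨u', v', hu', hsol⟩ := (isPair_H z).exists_isSolution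
    refine ⟨_, _, by simpa using hu', by simpa using hu0, hchain.snoc (hsol.congr ?_)⟩
    filter_upwards [Lp.coeFn_sub (H q z) (E • (z : L2)), Lp.coeFn_smul E (z : L2), hum, hu']
      with t hsub hsmul hut hut'
    rw [← hut, hsub, Pi.sub_apply, hsmul, Pi.smul_apply, hut', smul_eq_mul]
    ring

theorem le_analyticOrderAt_of_mem_kerPow (hq : LineIntegrable q) (hk : 0 < k.im) {m : ℕ}
    (hy : y ∈ (H q).kerPow (k ^ 2) (m + 1)) (hy' : y ∉ (H q).kerPow (k ^ 2) m) :
    ((m + 1 : ℕ) : ℕ∞) ≤ analyticOrderAt (jostWronskian q) k := by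
  obtain ⟨u, v, -, hu0, hchain⟩ := exists_isChain_of_mem_kerPow hy hy'
  exact hchain.le_analyticOrderAt hq hk hu0

theorem jostWronskian_eq_zero_of_isEigenvalue (hq : LineIntegrable q) (hk : 0 < k.im)
    (h : (H q).IsEigenvalue (k ^ 2)) : jostWronskian q k = 0 := by
  obtain ⟨y, hy, hpair⟩ := isEigenvalue_iff.1 h
  have horder := le_analyticOrderAt_of_mem_kerPow hq hk (m := 0) (mem_kerPow_one.2 hpair)
    (fun h => hy ((Submodule.mem_bot ℂ).1 h))
  exact apply_eq_zero_of_analyticOrderAt_ne_zero (zero_lt_one.trans_le (by simpa using horder)).ne'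

theorem isHalfLineSolution_jost (hq : HalfLineIntegrable q) (hk : 0 ≤ k.im) :
    IsHalfLineSolution q (jost q k) (jostDeriv q k) fun t => k ^ 2 * jost q k t where
  primitive := isHalfLinePrimitive_jost hq hk
  primitive_deriv := (isHalfLinePrimitive_jostDeriv hq hk).congr fun t _ => by ring

theorem IsSolution.exists_cauchyData_eq_mul {u v : ℝ → ℂ} (hq : LineIntegrable q) (hk : 0 ≤ k.im)
    (h : IsSolution q u v fun t => k ^ 2 * u t) :
    ∃ c, u 0 = c * jost q k 0 ∧ v 0 = c * jostDeriv q k 0 :=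
  exists_eq_mul_of_det_eq_zero (jost_cauchyData_ne_zero hq.halfLine hk) (h.wronskian_eq_zero hq hk)

theorem rank_kerPow_one_le (hq : LineIntegrable q) (hk : 0 ≤ k.im) :
    Module.rank ℂ ((H q).kerPow (k ^ 2) 1) ≤ 1 := by
  rw [rank_submodule_le_one_iff']
  by_cases hbot : (H q).kerPow (k ^ 2) 1 = ⊥
  · exact ⟨0, hbot.le.trans bot_le⟩
  obtain ⟨y₀, hy₀, hy₀_ne⟩ := Submodule.exists_mem_ne_zero_of_ne_bot hbot
  obtain ⟨u₀, v₀, hu₀, hsol₀⟩ := (mem_kerPow_one.1 hy₀).exists_isSolution_smul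
  obtain ⟨c₀, huc₀, hvc₀⟩ := hsol₀.exists_cauchyData_eq_mul hq hk
  have hc₀ : c₀ ≠ 0 := by
    rintro rfl
    rw [zero_mul] at huc₀ hvc₀
    exact ne_zero_of_ae_eq hu₀ hy₀_ne (hsol₀.eq_zero hq huc₀ hvc₀)
  refine ⟨y₀, fun y hy => Submodule.mem_span_singleton.2 ?_⟩
  obtain ⟨u, v, hu, hsol⟩ := (mem_kerPow_one.1 hy).exists_isSolution_smul
  obtain ⟨c, huc, hvc⟩ := hsol.exists_cauchyData_eq_mul hq hk
  have hdiff : (fun t => u t + -(c / c₀) * u₀ t) = 0 := by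
    refine IsSolution.eq_zero (E := k ^ 2) (v := fun t => v t + -(c / c₀) * v₀ t) hq ?_ ?_ ?_
    · convert hsol.add (hsol₀.const_mul (-(c / c₀))) using 2
      ring
    · rw [huc, huc₀]
      field_simp
      ring
    · rw [hvc, hvc₀]
      field_simp
      ring
  refine ⟨c / c₀, Lp.ext ?_⟩
  filter_upwards [Lp.coeFn_smul (c / c₀) y₀, hu, hu₀] with t hsmul hut hut₀
  rw [hsmul, Pi.smul_apply, hut, hut₀, smul_eq_mul]
  have hdiff_t := congrFun hdiff t
  rw [Pi.zero_apply] at hdiff_t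
  linear_combination -hdiff_t

theorem rootSpace_finiteDimensional_and_algMult_le (hq : LineIntegrable q) (hk : 0 < k.im)
    (horder : analyticOrderAt (jostWronskian q) k ≠ ⊤) :
    FiniteDimensional ℂ ((H q).rootSpace (k ^ 2)) ∧
      ((H q).algMult (k ^ 2) : ℕ∞) ≤ analyticOrderAt (jostWronskian q) k := by
  obtain ⟨n, hn⟩ := ENat.ne_top_iff_exists.1 horder
  have hstable : (H q).kerPow (k ^ 2) (n + 1) ≤ (H q).kerPow (k ^ 2) n := by
    intro y hy
    by_contra hy'
    have h := le_analyticOrderAt_of_mem_kerPow hq hk hy hy'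
    rw [← hn, Nat.cast_le] at h
    omega
  have hrank : Module.rank ℂ ((H q).rootSpace (k ^ 2)) ≤ n := by
    rw [rootSpace_eq_kerPow _ _ hstable]
    refine (rank_kerPow_le _ _ n).trans ?_
    simpa using mul_le_mul_right (rank_kerPow_one_le hq hk.le) (n : Cardinal)
  refine ⟨Module.rank_lt_aleph0_iff.1 (hrank.trans_lt Cardinal.natCast_lt_aleph0), ?_⟩
  rw [← hn, Nat.cast_le]
  exact Module.finrank_le_of_rank_le hrank

theorem tendsto_norm_jost_atTop (hq : HalfLineIntegrable q) (hk : k.im = 0) :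
    Tendsto (fun x => ‖jost q k x‖) atTop (𝓝 1) := by
  have hnorm (x : ℝ) : ‖jost q k x‖ = ‖jostReduced q k x‖ := by
    rw [jost, norm_mul, norm_exp_I_mul, hk]
    simp
  simpa [hnorm] using (tendsto_jostReduced_atTop hq hk.ge).norm

theorem im_ne_zero_of_isEigenvalue (hq : LineIntegrable q) (h : (H q).IsEigenvalue (k ^ 2)) :
    k.im ≠ 0 := by
  intro hk
  obtain ⟨y, hy, hpair⟩ := isEigenvalue_iff.1 h
  obtain ⟨u, v, hu, hsol⟩ := hpair.exists_isSolution_smul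
  obtain ⟨c, huc, hvc⟩ := hsol.exists_cauchyData_eq_mul hq hk.ge
  have hu_eq (x : ℝ) (hx : 0 ≤ x) : u x = c * jost q k x := by
    have hdiff := IsHalfLineSolution.eq_zero (E := k ^ 2) hq.halfLine (((hsol.right.add
      ((isHalfLineSolution_jost hq.halfLine hk.ge).const_mul (-c)))).congr_ae
        (.of_forall fun t _ => by ring)) (by rw [huc]; ring) (by rw [hvc]; ring) hx
    linear_combination hdiff
  have hlim : Tendsto (fun x => ‖u x‖ ^ 2) atTop (𝓝 (‖c‖ ^ 2)) := by
    have hjost := ((tendsto_norm_jost_atTop hq.halfLine hk).const_mul ‖c‖).pow 2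
    rw [mul_one] at hjost
    refine hjost.congr' ?_
    filter_upwards [eventually_ge_atTop 0] with x hx
    rw [hu_eq x hx, norm_mul]
  have hsq : ‖c‖ ^ 2 = 0 := by
    refine IntegrableAtFilter.eq_zero_of_tendsto (μ := volume)
      ⟨Ioi 0, Ioi_mem_atTop 0, hsol.integrableOn_sq⟩ (fun s hs => ?_) hlim
    obtain ⟨a, ha⟩ := mem_atTop_sets.1 hs
    exact measure_mono_top ha Real.volume_Ici
  have hc : c = 0 := by simpa using hsq
  rw [hc, zero_mul] at huc hvc
  exact ne_zero_of_ae_eq hu hy (hsol.eq_zero hq huc hvc)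

theorem exists_jostWronskian_eq_zero_of_isEigenvalue (hq : LineIntegrable q)
    (h : (H q).IsEigenvalue E) : ∃ k : ℂ, 0 < k.im ∧ E = k ^ 2 ∧ jostWronskian q k = 0 := by
  obtain ⟨k, hk, rfl⟩ : ∃ k : ℂ, 0 ≤ k.im ∧ E = k ^ 2 := by
    obtain ⟨k, rfl⟩ := IsAlgClosed.exists_pow_nat_eq E two_pos
    rcases le_total 0 k.im with hk | hk
    · exact ⟨k, hk, rfl⟩
    · exact ⟨-k, by simpa using hk, (neg_sq k).symm⟩
  have hk' : 0 < k.im := hk.lt_of_ne' (im_ne_zero_of_isEigenvalue hq h)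
  exact ⟨k, hk', rfl, jostWronskian_eq_zero_of_isEigenvalue hq hk' h⟩

end Eigenvectors

/-! ### Eigenfunctions from zeros of the Jost Wronskian -/

section Glue

variable {q u v g a a' b b' : ℝ → ℂ} {k E : ℂ} {t : ℝ}

/-- The function on the line equal to `a` on `[0, ∞)` and to the reflection of `b` on `(-∞, 0)`. -/
noncomputable def glue (a b : ℝ → ℂ) : ℝ → ℂ := (Ici 0).piecewise a fun t => b (-t)

theorem glue_of_nonneg (ht : 0 ≤ t) : glue a b t = a t :=
  piecewise_eq_of_mem _ _ _ (mem_Ici.2 ht)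

theorem glue_neg (h0 : a 0 = b 0) (ht : 0 ≤ t) : glue a b (-t) = b t := by
  rcases ht.eq_or_lt with rfl | ht
  · rw [neg_zero, glue_of_nonneg le_rfl, h0]
  · rw [glue, piecewise_eq_of_notMem _ _ _ (by simpa using ht), neg_neg]

theorem memLp_glue (ha : MemLp a 2 (volume.restrict (Ioi 0)))
    (hb : MemLp b 2 (volume.restrict (Ioi 0))) : MemLp (glue a b) 2 volume := by
  refine MemLp.piecewise measurableSet_Ici ?_ ?_
  · rwa [← restrict_Ioi_eq_restrict_Ici]
  · rw [compl_Ici]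
    have hneg := (Measure.measurePreserving_neg (volume : Measure ℝ)).restrict_preimage
      (measurableSet_Ioi (a := 0))
    rw [neg_preimage, neg_Ioi, neg_zero] at hneg
    exact hb.comp_measurePreserving hneg

theorem IsHalfLineSolution.isSolution_glue (hr : IsHalfLineSolution q a a' fun t => E * a t)
    (hl : IsHalfLineSolution (refl q) b b' fun t => E * b t)
    (ha : MemLp a 2 (volume.restrict (Ioi 0))) (hb : MemLp b 2 (volume.restrict (Ioi 0)))
    (h0 : a 0 = b 0) (h1 : a' 0 = -b' 0) :
    IsSolution q (glue a b) (glue a' fun t => -b' t) fun t => E * glue a b t where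
  memLp := memLp_glue ha hb
  right :=
    { primitive := (hr.primitive.congr_left fun t ht => (glue_of_nonneg ht).symm).congr
        fun t ht => (glue_of_nonneg ht.le).symm
      primitive_deriv := (hr.primitive_deriv.congr_left fun t ht => (glue_of_nonneg ht).symm).congr
        fun t ht => by rw [glue_of_nonneg ht.le] }
  left :=
    { primitive := (hl.primitive.congr_left fun t ht => (glue_neg h0 ht).symm).congr
        fun t ht => by rw [glue_neg h1 ht.le, neg_neg]
      primitive_deriv := (hl.primitive_deriv.congr_left fun t ht => by
        rw [glue_neg h1 ht, neg_neg]).congr fun t ht => by rw [glue_neg h0 ht.le] }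

theorem IsSolution.sub_eq_integral (h : IsSolution q u v g) (a b : ℝ) :
    IntervalIntegrable (fun t => q t * u t - g t) volume a b ∧
      v b - v a = ∫ t in a..b, (q t * u t - g t) := by
  refine h.right.primitive_deriv.sub_eq_integral_of_reflect ?_ a b
  have hneg := h.left.primitive_deriv.const_mul (-1)
  simp only [neg_one_mul, neg_neg] at hneg
  exact hneg

theorem IsSolution.hasDerivAt (h : IsSolution q u v g) (x : ℝ) : HasDerivAt u (v x) x := by
  have hv : Continuous v := continuous_of_sub_eq_integral
    (fun a b => (h.sub_eq_integral a b).1) fun a b => (h.sub_eq_integral a b).2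
  have hu := h.right.primitive.sub_eq_integral_of_reflect h.left.primitive 0
  have hint : HasDerivAt (fun x => u 0 + ∫ t in (0 : ℝ)..x, v t) (v x) x :=
    (hv.integral_hasStrictDerivAt 0 x).hasDerivAt.const_add _
  exact hint.congr_of_eventuallyEq (.of_forall fun x => sub_eq_iff_eq_add'.1 (hu x).2)

theorem IsSolution.isPair {y f : L2} (h : IsSolution q u v g) (hy : (y : ℝ → ℂ) =ᵐ[volume] u)
    (hf : (f : ℝ → ℂ) =ᵐ[volume] g) : IsPair q y f := by
  have hsource : (fun t => q t * u t - g t) =ᵐ[volume] fun t => q t * u t - f t := by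
    filter_upwards [hf] with t ht using by rw [ht]
  refine ⟨u, v, hy, h.hasDerivAt,
    fun a b => (h.sub_eq_integral a b).1.congr_ae (ae_restrict_of_ae hsource), fun a b => ?_⟩
  rw [(h.sub_eq_integral a b).2,
    intervalIntegral.integral_congr_ae (hsource.mono fun _ ht _ => ht)]

theorem IsSolution.isEigenvalue (h : IsSolution q u v fun t => E * u t)
    (hne : ¬ (u 0 = 0 ∧ v 0 = 0)) : (H q).IsEigenvalue E := by
  refine isEigenvalue_iff.2 ⟨h.memLp.toLp u, fun hy => hne ?_, h.isPair h.memLp.coeFn_toLp ?_⟩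
  · have hcont : Continuous u :=
      continuous_iff_continuousAt.2 fun x => (h.hasDerivAt x).continuousAt
    have hu : u = 0 := (hcont.ae_eq_iff_eq volume continuous_zero).1
      (h.memLp.coeFn_toLp.symm.trans (Lp.eq_zero_iff_ae_eq_zero.1 hy))
    subst hu
    exact ⟨rfl, (h.hasDerivAt 0).unique (hasDerivAt_const 0 0)⟩
  · filter_upwards [Lp.coeFn_smul E (h.memLp.toLp u), h.memLp.coeFn_toLp] with t hsmul ht
    rw [hsmul, Pi.smul_apply, ht, smul_eq_mul]

theorem memLp_jost (hq : HalfLineIntegrable q) (hk : 0 < k.im) :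
    MemLp (jost q k) 2 (volume.restrict (Ioi 0)) := by
  have hmeas : AEStronglyMeasurable (jost q k) (volume.restrict (Ioi 0)) :=
    ((isHalfLinePrimitive_jost hq hk.le).continuousOn.mono
      Ioi_subset_Ici_self).aestronglyMeasurable measurableSet_Ioi
  refine (memLp_two_iff_integrable_sq_norm hmeas).2 <|
    ((integrableOn_exp_neg hk).const_mul (Real.exp (momentTail q 0) ^ 2)).mono'
      (hmeas.norm.pow 2) (ae_restrict_of_forall_mem measurableSet_Ioi fun t ht => ?_)
  rw [Real.norm_of_nonneg (by positivity)]
  exact norm_jost_sq_le hq hk le_rfl (le_of_lt ht)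

theorem isEigenvalue_of_jostWronskian_eq_zero (hq : LineIntegrable q) (hk : 0 < k.im)
    (hW : jostWronskian q k = 0) : (H q).IsEigenvalue (k ^ 2) := by
  obtain ⟨c, hc0, hc1⟩ : ∃ c, jost (refl q) k 0 = c * jost q k 0 ∧
      -jostDeriv (refl q) k 0 = c * jostDeriv q k 0 :=
    exists_eq_mul_of_det_eq_zero (jost_cauchyData_ne_zero hq.halfLine hk.le)
      (by rw [← hW, jostWronskian]; ring)
  have hsol := ((isHalfLineSolution_jost hq.halfLine hk.le).const_mul c).congr_ae
    (g' := fun t => k ^ 2 * (c * jost q k t)) (.of_forall fun t _ => by ring)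
  refine (hsol.isSolution_glue (isHalfLineSolution_jost hq.refl.halfLine hk.le)
    ((memLp_jost hq.halfLine hk).const_mul c) (memLp_jost hq.refl.halfLine hk)
    hc0.symm hc1.symm).isEigenvalue ?_
  rw [glue_of_nonneg le_rfl, glue_of_nonneg le_rfl, ← hc0, ← hc1, neg_eq_zero]
  exact jost_cauchyData_ne_zero hq.refl.halfLine hk.le

end Glue

/-! ### The Blaschke product of the eigenvalues -/

section Zeros

variable {q : ℝ → ℂ} {k : ℂ}

theorem constA_nonneg : 0 ≤ constA q :=
  mul_nonneg (mul_nonneg (integral_nonneg fun _ => norm_nonneg _)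
    (integral_nonneg fun _ => by positivity)) (Real.exp_nonneg _)

/-- The bound `A + |q₀|` for the distance of the Jost Wronskian at `k` from its free value `2ik`. -/
noncomputable def radius (q : ℝ → ℂ) : ℝ := constA q + ‖∫ t, q t‖

theorem radius_nonneg : 0 ≤ radius q := add_nonneg constA_nonneg (norm_nonneg _)

theorem norm_jostWronskian_sub_two_I_mul_le (hq : LineIntegrable q) (hk : 0 ≤ k.im) :
    ‖jostWronskian q k - 2 * I * k‖ ≤ radius q := by
  calc ‖jostWronskian q k - 2 * I * k‖
      = ‖(jostWronskian q k - 2 * I * k + ∫ t, q t) - ∫ t, q t‖ := by rw [add_sub_cancel_right]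
    _ ≤ ‖jostWronskian q k - 2 * I * k + ∫ t, q t‖ + ‖∫ t, q t‖ := norm_sub_le _ _
    _ ≤ radius q := add_le_add_left (norm_jostWronskian_sub_le hq hk) _

theorem two_mul_norm_le_of_jostWronskian_eq_zero (hq : LineIntegrable q) (hk : 0 ≤ k.im)
    (hW : jostWronskian q k = 0) : 2 * ‖k‖ ≤ radius q := by
  simpa [hW] using norm_jostWronskian_sub_two_I_mul_le hq hk

theorem exists_jostWronskian_ne_zero (hq : LineIntegrable q) :
    ∃ k : ℂ, 0 < k.im ∧ jostWronskian q k ≠ 0 := by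
  have hr : 0 < radius q + 1 := by linarith [radius_nonneg (q := q)]
  have him : (((radius q + 1 : ℝ) : ℂ) * I).im = radius q + 1 := by simp
  refine ⟨((radius q + 1 : ℝ) : ℂ) * I, by rwa [him], fun hW => ?_⟩
  have h := two_mul_norm_le_of_jostWronskian_eq_zero hq (by rw [him]; exact hr.le) hW
  rw [norm_mul, Complex.norm_I, mul_one, Complex.norm_of_nonneg hr.le] at h
  linarith

theorem analyticAt_jostWronskian (hq : LineIntegrable q) (hk : 0 < k.im) :
    AnalyticAt ℂ (jostWronskian q) k :=
  (differentiableOn_jostWronskian hq).analyticAt (isOpen_upperHalfPlaneSet.mem_nhds hk)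

theorem analyticOrderAt_jostWronskian_ne_top (hq : LineIntegrable q) (hk : 0 < k.im) :
    analyticOrderAt (jostWronskian q) k ≠ ⊤ := by
  intro htop
  obtain ⟨z, hz, hWz⟩ := exists_jostWronskian_ne_zero hq
  have hW : AnalyticOnNhd ℂ (jostWronskian q) upperHalfPlaneSet := fun w hw =>
    analyticAt_jostWronskian hq hw
  exact hWz (hW.eqOn_zero_of_preconnected_of_eventuallyEq_zero
    (convex_halfSpace_im_gt 0).isPreconnected hk (analyticOrderAt_eq_top.1 htop) hz)

theorem norm_jostWronskian_mul_inv_add_I_le (hq : LineIntegrable q) (hk : 0 < k.im) :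
    ‖jostWronskian q k * (k + I)⁻¹‖ ≤ 2 + radius q := by
  have hone : 1 ≤ ‖k + I‖ := by
    have := Complex.im_le_norm (k + I)
    rw [Complex.add_im, Complex.I_im] at this
    linarith
  have hW : ‖jostWronskian q k‖ ≤ (2 + radius q) * ‖k + I‖ := calc
    ‖jostWronskian q k‖ ≤ ‖2 * I * k‖ + ‖jostWronskian q k - 2 * I * k‖ := norm_le_insert' _ _
    _ ≤ 2 * ‖k + I‖ + radius q * ‖k + I‖ := by
      refine add_le_add ?_ ((norm_jostWronskian_sub_two_I_mul_le hq hk.le).trans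
        (le_mul_of_one_le_right radius_nonneg hone))
      simpa using norm_le_norm_add_I hk.le
    _ = (2 + radius q) * ‖k + I‖ := by ring
  rwa [norm_mul, norm_inv, ← div_eq_mul_inv, div_le_iff₀ (zero_lt_one.trans_le hone)]

theorem algMult_le_analyticOrderAt_mul_inv_add_I (hq : LineIntegrable q) (hk : 0 < k.im) :
    ((H q).algMult (k ^ 2) : ℕ∞) ≤ analyticOrderAt (fun z => jostWronskian q z * (z + I)⁻¹) k := by
  refine (rootSpace_finiteDimensional_and_algMult_le hq hk
    (analyticOrderAt_jostWronskian_ne_top hq hk)).2.trans ?_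
  have hmul := analyticOrderAt_mul (analyticAt_jostWronskian hq hk)
    (AnalyticAt.inv (f := fun z => z + I) (by fun_prop) (add_I_ne_zero hk))
  exact le_self_add.trans_eq hmul.symm

theorem encard_fiber_index_le (q : ℝ → ℂ) (z : ℂ) :
    ((fun j : Index q => (j.1 : ℂ)) ⁻¹' {z}).encard ≤ (H q).algMult (z ^ 2) := by
  by_cases hz : z ∈ momenta q
  · have hsub : (fun j : Index q => (j.1 : ℂ)) ⁻¹' {z} ⊆
        range (Sigma.mk (⟨z, hz⟩ : momenta q)) := by
      rintro ⟨⟨κ, hκ⟩, i⟩ rfl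
      exact mem_range_self i
    refine (encard_le_encard hsub).trans ?_
    rw [← image_univ]
    refine (encard_image_le _ _).trans ?_
    simp
  · have hempty : (fun j : Index q => (j.1 : ℂ)) ⁻¹' {z} = ∅ :=
      eq_empty_of_forall_notMem fun j hj => hz (hj ▸ j.1.2)
    simp [hempty]

theorem summable_im_index (hq : LineIntegrable q) :
    Summable fun j : Index q => (j.1 : ℂ).im := by
  obtain ⟨z, hz, hWz⟩ := exists_jostWronskian_ne_zero hq
  refine summable_im_of_encard_le_analyticOrderAt (R := radius q) (fun j => j.1.2.1) (fun j => ?_)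
    ((differentiableOn_jostWronskian hq).mul
      (DifferentiableOn.inv (by fun_prop) fun _ => add_I_ne_zero))
    (fun _ => norm_jostWronskian_mul_inv_add_I_le hq)
    (fun w hw => (encard_fiber_index_le q w).trans
      (algMult_le_analyticOrderAt_mul_inv_add_I hq hw)) hz
    (mul_ne_zero hWz (inv_ne_zero (add_I_ne_zero hz)))
  have h := two_mul_norm_le_of_jostWronskian_eq_zero hq j.1.2.1.le
    (jostWronskian_eq_zero_of_isEigenvalue hq j.1.2.1 j.1.2.2)
  linarith [norm_nonneg (j.1 : ℂ)]

theorem summable_norm_factor_sub_one (hq : LineIntegrable q) (hk : 0 < k.im) :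
    Summable fun j : Index q => ‖factor q k j - 1‖ :=
  summable_norm_blaschkeFactor_sub_one (fun j => j.1.2.1) (summable_im_index hq) hk

theorem differentiableOn_blaschke (hq : LineIntegrable q) :
    DifferentiableOn ℂ (blaschke q) upperHalfPlaneSet :=
  differentiableOn_tprod_blaschkeFactor (fun j : Index q => j.1.2.1) (summable_im_index hq)

theorem hardyNorm_blaschke_le_one (hq : LineIntegrable q) : hardyNorm (blaschke q) ≤ 1 := by
  refine iSup₂_le fun k hk => ?_
  rw [← ofReal_norm]
  exact ENNReal.ofReal_le_one.2
    (norm_tprod_blaschkeFactor_le_one (fun j : Index q => j.1.2.1) (summable_im_index hq) hk)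

end Zeros

/-! ### Counting eigenvalues -/

section Counting

variable {q : ℝ → ℂ}

theorem not_isEigenvalue_of_lt (hq : LineIntegrable q) (hA : constA q < (∫ x, q x).re) (E : ℂ) :
    ¬ (H q).IsEigenvalue E := by
  intro hE
  obtain ⟨k, hk, -, hW⟩ := exists_jostWronskian_eq_zero_of_isEigenvalue hq hE
  have hle := (Complex.re_le_norm _).trans (norm_jostWronskian_sub_le hq hk.le)
  have hre : (jostWronskian q k - 2 * I * k + ∫ x, q x).re = 2 * k.im + (∫ x, q x).re := by
    simp [hW]
  linarith

/-- The map `k ↦ k - W(k) / (2i)`, whose fixed points are the zeros of the Jost Wronskian `W`. -/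
noncomputable def jostMap (q : ℝ → ℂ) (k : ℂ) : ℂ := k - jostWronskian q k / (2 * I)

theorem jostMap_eq_self_iff {k : ℂ} : jostMap q k = k ↔ jostWronskian q k = 0 := by
  simp [jostMap]

theorem differentiableOn_jostMap (hq : LineIntegrable q) :
    DifferentiableOn ℂ (jostMap q) upperHalfPlaneSet :=
  differentiableOn_id.sub ((differentiableOn_jostWronskian hq).div_const _)

theorem mapsTo_jostMap (hq : LineIntegrable q) :
    MapsTo (jostMap q) upperHalfPlaneSet
      (Metric.closedBall ((∫ x, q x) / (2 * I)) (constA q / 2)) := by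
  intro z hz
  have hsub : jostMap q z - (∫ x, q x) / (2 * I) =
      -(jostWronskian q z - 2 * I * z + ∫ x, q x) / (2 * I) := by
    rw [jostMap]
    have := Complex.I_ne_zero
    field_simp
    ring
  rw [mem_closedBall_iff_norm, hsub, norm_div, norm_neg]
  simpa using div_le_div_of_nonneg_right (norm_jostWronskian_sub_le hq (le_of_lt hz)) zero_le_two

theorem exists_unique_jostWronskian_eq_zero (hq : LineIntegrable q)
    (hA : constA q < (-∫ x, q x).re) :
    ∃ κ : ℂ, 0 < κ.im ∧ analyticOrderAt (jostWronskian q) κ = 1 ∧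
      ∀ k : ℂ, 0 < k.im → (jostWronskian q k = 0 ↔ k = κ) := by
  have hKU : Metric.closedBall ((∫ x, q x) / (2 * I)) (constA q / 2) ⊆ upperHalfPlaneSet := by
    refine closedBall_subset_upperHalfPlaneSet ?_
    have him : ((∫ x, q x) / (2 * I)).im = (-∫ x, q x).re / 2 := by
      rw [mul_comm, ← div_div, Complex.div_I]
      simp
    linarith
  have hd := differentiableOn_jostMap hq
  have hK := isCompact_closedBall ((∫ x, q x) / (2 * I)) (constA q / 2)
  have hmaps := mapsTo_jostMap hq
  obtain ⟨κ, hκK, hκfix⟩ := exists_fixedPoint_of_mapsTo_compact hd hK hKU hmaps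
  have hκ : 0 < κ.im := hKU hκK
  have hWκ := jostMap_eq_self_iff.1 hκfix
  have hWan := analyticAt_jostWronskian hq hκ
  refine ⟨κ, hκ, hWan.analyticOrderAt_eq_one_of_zero_deriv_ne_zero hWκ fun hW' => ?_, fun k hk =>
    ⟨fun hWk => fixedPoint_unique_of_mapsTo_compact hd hK hKU hmaps hκ hk hκfix
      (jostMap_eq_self_iff.2 hWk), fun h => h ▸ hWκ⟩⟩
  have hderiv : HasDerivAt (jostMap q) 1 κ := by
    refine ((hasDerivAt_id κ).sub
      (hWan.differentiableAt.hasDerivAt.div_const (2 * I))).congr_deriv ?_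
    rw [hW', zero_div, sub_zero]
  have hlt := norm_deriv_fixedPoint_lt_one hd hK hKU hmaps hκ hκfix
  rw [hderiv.deriv, norm_one] at hlt
  exact lt_irrefl _ hlt

theorem algMult_pos_of_isEigenvalue {E : ℂ} (h : (H q).IsEigenvalue E)
    (hfin : FiniteDimensional ℂ ((H q).rootSpace E)) : 0 < (H q).algMult E := by
  obtain ⟨y, hy, hpair⟩ := isEigenvalue_iff.1 h
  have hmem : y ∈ (H q).rootSpace E := le_iSup ((H q).kerPow E) 1 (mem_kerPow_one.2 hpair)
  have : Nontrivial ((H q).rootSpace E) :=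
    nontrivial_of_ne ⟨y, hmem⟩ 0 fun h0 => hy (congrArg Subtype.val h0)
  exact Module.finrank_pos

theorem exists_unique_eigenvalue (hq : LineIntegrable q) (hA : constA q < (-∫ x, q x).re) :
    ∃ κ : ℂ, 0 < κ.im ∧ (∀ E : ℂ, (H q).IsEigenvalue E ↔ E = κ ^ 2) ∧
      (H q).algMult (κ ^ 2) = 1 := by
  obtain ⟨κ, hκ, horder, huniq⟩ := exists_unique_jostWronskian_eq_zero hq hA
  have hev : (H q).IsEigenvalue (κ ^ 2) :=
    isEigenvalue_of_jostWronskian_eq_zero hq hκ ((huniq κ hκ).2 rfl)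
  refine ⟨κ, hκ, fun E => ⟨fun hE => ?_, fun hE => hE ▸ hev⟩, le_antisymm ?_ ?_⟩
  · obtain ⟨k, hk, rfl, hWk⟩ := exists_jostWronskian_eq_zero_of_isEigenvalue hq hE
    rw [(huniq k hk).1 hWk]
  all_goals
    obtain ⟨hfin, hle⟩ := rootSpace_finiteDimensional_and_algMult_le hq hκ
      (analyticOrderAt_jostWronskian_ne_top hq hκ)
  · exact_mod_cast hle.trans_eq horder
  · exact algMult_pos_of_isEigenvalue hev hfin

end Counting

end Schrodinger

theorem proposition1p1 (q : ℝ → ℂ) (hq : AEStronglyMeasurable q volume)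
    (hint : Integrable (fun x : ℝ => (1 + |x|) * ‖q x‖) volume) :
    ((∀ κ ∈ Schrodinger.momenta q,
          FiniteDimensional ℂ ((Schrodinger.H q).rootSpace (κ ^ 2))) ∧
        (∀ k : ℂ, 0 < k.im →
          Summable (fun j : Schrodinger.Index q => ‖Schrodinger.factor q k j - 1‖)) ∧
        Schrodinger.MemHardy (Schrodinger.blaschke q) ∧
        Schrodinger.hardyNorm (Schrodinger.blaschke q) ≤ 1) ∧
      (Schrodinger.constA q < (∫ x, q x).re →
        ∀ E : ℂ, ¬ (Schrodinger.H q).IsEigenvalue E) ∧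
      (Schrodinger.constA q < (-∫ x, q x).re →
        ∃ κ : ℂ, 0 < κ.im ∧
          (∀ E : ℂ, (Schrodinger.H q).IsEigenvalue E ↔ E = κ ^ 2) ∧
          (Schrodinger.H q).algMult (κ ^ 2) = 1) := by
  have hq' := Schrodinger.LineIntegrable.of_weight hq hint
  have hnorm := Schrodinger.hardyNorm_blaschke_le_one hq'
  refine ⟨⟨fun κ hκ => ?_, fun k hk => Schrodinger.summable_norm_factor_sub_one hq' hk,
      ⟨Schrodinger.differentiableOn_blaschke hq', hnorm.trans_lt ENNReal.one_lt_top⟩, hnorm⟩,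
    Schrodinger.not_isEigenvalue_of_lt hq', Schrodinger.exists_unique_eigenvalue hq'⟩
  exact (Schrodinger.rootSpace_finiteDimensional_and_algMult_le hq' hκ.1
    (Schrodinger.analyticOrderAt_jostWronskian_ne_top hq' hκ.1)).1
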